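/- **Problem data.** Let $n,m,N\in\mathbb N$, let $g_i:\mathbb R^n\to\mathbb R$, $h_i:\mathbb R^m\to\mathbb R$, $f_i:\mathbb R^n\times\mathbb R^m\to\mathbb R$ $(i=1,\dots,N)$, and let $\varphi:\mathbb R^n\to(-\infty,\infty]$, $\psi:\mathbb R^m\to(-\infty,\infty]$ be proper, closed and convex. Put $\phi^x_{y,i}(x):=g_i(x)+f_i(x,y)$ and $\phi^y_{x,i}(y):=h_i(y)-f_i(x,y)$. A star denotes the convex conjugate (with respect to $x$, resp. $y$), and $\mathcal D^x_i:=\operatorname{int}\operatorname{dom}(\phi^x_{y,i})^*$, $\mathcal D^y_i:=\operatorname{int}\operatorname{dom}(\phi^y_{x,i})^*$. Write $\operatorname{prox}_{\alpha\varphi}(x)=\arg\min_z\{\alpha\varphi(z)+\frac12\|x-z\|^2\}$ and $\operatorname{env}_{\alpha\varphi}(x)$ for the corresponding minimal value. $\partial G$ is Clarke's generalized Jacobian. A locally Lipschitz map $G$ on an open set $V$ is *semismooth* (resp. *$\nu$-order semismooth*) on $V$ if at each $x\in V$ it is directionally differentiable and $\sup_{M\in\partial G(x+s)}\|G(x+s)-G(x)-Ms\|$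 is $o(\|s\|)$ (resp. $O(\|s\|^{1+\nu})$) as $s\to0$. **Assumptions.** 1. For every $i$, the functions $g_i,h_i,f_i$ are continuously differentiable, $g_i,h_i$ are convex, $f_i$ is convex in $x$ and concave in $y$; $\nabla g_i$, $\nabla h_i$ are Lipschitz on their spaces and $\nabla_xf_i,\nabla_yf_i$ are Lipschitz on $\mathbb R^n\times\mathbb R^m$; there are $\mu^i_x,\mu^i_y>0$ such that $\phi^x_{y,i}$ is $\mu_x^i$-strongly convex for every $y$ and $-\phi^y_{x,i}$ is $\mu_y^i$-strongly concave for every $x$. 2. $\operatorname{prox}_{\alpha\varphi}$ and $\operatorname{prox}_{\alpha\psi}$ are semismooth on $\mathbb R^n$ and $\mathbb R^m$ for every $\alpha>0$. 3. For all $i,x,y$, the conjugates $(\phi^x_{y,i})^*$, $(\phi^y_{x,i})^*$ are essentially differentiable (the interior of the domain is nonempty, the function is differentiable there, and the norm of the gradient tends to infinity along every sequence in the interior that converges to a boundary point of it), with locally Lipschitz gradients on $\mathcal D^x_i$, $\mathcal D^y_i$. 4. For all $i,x,y$, the maps $\nabla(\phi^x_{y,i})^*$, $\nabla(\phi^y_{x,i})^*$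 are semismooth on $\mathcal D^x_i$, $\mathcal D^y_i$. **Subproblems.** Let $b\ge1$, let $\kappa(1),\dots,\kappa(b)\in\{1,\dots,N\}$ be a batch, $\alpha>0$, let $x,\hat v^x\in\mathbb R^n$ be a current point and a correction vector, and fix the other variable $y'\in\mathbb R^m$. For $\xi=(\xi_1,\dots,\xi_b)\in\mathcal D^x:=\prod_{i=1}^b\mathcal D^x_{\kappa(i)}$ (with $y=y'$ in the definition of $\mathcal D^x_i$), let $u(\xi):=x-\hat v^x-\frac\alpha b\sum_{i=1}^b\xi_i$ and $$\mathcal F^x_{y}(\xi):=\big(\nabla(\phi^x_{y',\kappa(i)})^*(\xi_i)-\operatorname{prox}_{\alpha\varphi}(u(\xi))\big)_{i=1}^b,$$ $$\mathcal I^x_{y}(\xi):=\sum_{i=1}^b(\phi^x_{y',\kappa(i)})^*(\xi_i)+\frac b{2\alpha}\|u(\xi)\|^2-\frac b\alpha\operatorname{env}_{\alpha\varphi}(u(\xi)).$$ With $\mathcal A:=\frac1b[I,\dots,I]^\top$, the surrogate differential $\hat\partial\mathcal F^x_{y}(\xi)$ is the set of all $\operatorname{blkdiag}(H_1,\dots,H_b)+\alpha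 b\,\mathcal AU\mathcal A^\top$ with $H_i\in\partial(\nabla(\phi^x_{y',\kappa(i)})^*)(\xi_i)$ and $U\in\partial\operatorname{prox}_{\alpha\varphi}(u(\xi))$. Define $\mathcal D^y$, $\mathcal F^y_{x}$, $\mathcal I^y_{x}$, $\hat\partial\mathcal F^y_{x}$ analogously with $\phi^y_{x',i}$, $\psi$, a current point $y$, a correction vector $\hat v^y$, and a fixed $x'\in\mathbb R^n$. **Algorithm** (for $(\mathcal D,\mathcal F,\mathcal I)=(\mathcal D^x,\mathcal F^x_{y},\mathcal I^x_{y})$ or $(\mathcal D^y,\mathcal F^y_{x},\mathcal I^y_{x})$). Parameters $\hat\gamma\in(0,\frac12)$, $\rho,\tau_1,\tau_2\in(0,1)$, $\tau\in(0,1]$; start at $\xi^0\in\mathcal D$. As long as $\mathcal F(\xi^j)\ne0$: choose $W_j\in\hat\partial\mathcal F(\xi^j)$, put $\eta_j=\tau_1\min\{\tau_2,\|\mathcal F(\xi^j)\|\}$, let $d^j$ be an iterate of the conjugate gradient method, started at $0$, for $(W_j+\eta_jI)d=-\mathcal F(\xi^j)$ with $\|(W_j+\eta_jI)d^j+\mathcal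 F(\xi^j)\|\le\min\{\eta_j,\|\mathcal F(\xi^j)\|^{1+\tau}\}$, let $\ell_j\ge0$ be the smallest integer with $\xi^j+\rho^{\ell_j}d^j\in\mathcal D$ and $\mathcal I(\xi^j+\rho^{\ell_j}d^j)\le\mathcal I(\xi^j)+\hat\gamma\rho^{\ell_j}\langle\nabla\mathcal I(\xi^j),d^j\rangle$, and set $\xi^{j+1}=\xi^j+\rho^{\ell_j}d^j$. If $\mathcal F(\xi^j)=0$, the method stops, and the sequence is continued constantly. **Theorem.** Under assumptions 1–4, each of the systems $\mathcal F^x_{y}(\xi)=0$, $\xi\in\mathcal D^x$, and $\mathcal F^y_{x}(\xi)=0$, $\xi\in\mathcal D^y$, has a unique solution $\hat\xi$, and every sequence $(\xi^j)$ generated by the algorithm for that system converges q-superlinearly to it: $\xi^j\to\hat\xi$ and $$\|\xi^{j+1}-\hat\xi\|=o(\|\xi^j-\hat\xi\|)\quad(j\to\infty).$$ Moreover, the unit step is eventually accepted: $\ell_j=0$ for all sufficiently large $j$ at which the method has not stopped. If, in addition, for some $\nu\in(0,1]$ the maps $\operatorname{prox}_{\alpha'\varphi}$, $\operatorname{prox}_{\alpha'\psi}$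 are $\nu$-order semismooth on $\mathbb R^n$, $\mathbb R^m$ for every $\alpha'>0$ and $\nabla(\phi^x_{y,i})^*$, $\nabla(\phi^y_{x,i})^*$ are $\nu$-order semismooth on $\mathcal D^x_i$, $\mathcal D^y_i$ for all $i,x,y$, then $$\|\xi^{j+1}-\hat\xi\|=O\big(\|\xi^j-\hat\xi\|^{1+\min\{\tau,\nu\}}\big)\quad(j\to\infty).$$ -/

import Mathlib

open Set Filter Topology Asymptotics

noncomputable section

namespace SSN

section Basic

variable {E : Type*} [NormedAddCommGroup E] [InnerProductSpace ℝ E]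
variable {G : Type*} [NormedAddCommGroup G] [NormedSpace ℝ G]

/-! ### Nonsmooth analysis -/

/-- Clarke's generalized Jacobian: the convex hull of all limits of derivatives `F'(u k)` along
sequences `u k → x` of points of differentiability of `F`. -/
def clarkeJacobian (F : E → G) (x : E) : Set (E →L[ℝ] G) :=
  convexHull ℝ {M | ∃ u : ℕ → E, Tendsto u atTop (𝓝 x) ∧ (∀ k, DifferentiableAt ℝ F (u k)) ∧
    Tendsto (fun k => fderiv ℝ F (u k)) atTop (𝓝 M)}

/-- The one-sided directional derivative of `F` at `x` exists in every direction. -/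
def DirDifferentiableAt (F : E → G) (x : E) : Prop :=
  ∀ h : E, ∃ D : G, Tendsto (fun t : ℝ => t⁻¹ • (F (x + t • h) - F x)) (𝓝[>] 0) (𝓝 D)

/-- `F` is semismooth on the (open) set `V`, with respect to Clarke's generalized Jacobian:
`sup_{M ∈ ∂F(x+s)} ‖F (x+s) - F x - M s‖ = o(‖s‖)` at every `x ∈ V`. -/
def SemismoothOn (F : E → G) (V : Set E) : Prop :=
  LocallyLipschitzOn V F ∧ ∀ x ∈ V, DirDifferentiableAt F x ∧
    ∀ ε : ℝ, 0 < ε → ∀ᶠ s in 𝓝 (0 : E), ∀ M ∈ clarkeJacobian F (x + s),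
      ‖F (x + s) - F x - M s‖ ≤ ε * ‖s‖

/-- `F` is `ν`-order semismooth on the (open) set `V`:
`sup_{M ∈ ∂F(x+s)} ‖F (x+s) - F x - M s‖ = O(‖s‖ ^ (1+ν))` at every `x ∈ V`. -/
def OrderSemismoothOn (ν : ℝ) (F : E → G) (V : Set E) : Prop :=
  LocallyLipschitzOn V F ∧ ∀ x ∈ V, DirDifferentiableAt F x ∧
    ∃ C : ℝ, ∀ᶠ s in 𝓝 (0 : E), ∀ M ∈ clarkeJacobian F (x + s),
      ‖F (x + s) - F x - M s‖ ≤ C * ‖s‖ ^ (1 + ν)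

/-! ### Convex analysis -/

/-- An extended real-valued function with values in `(-∞, ∞]` that is proper, closed (that is,
lower semicontinuous) and convex (that is, with convex epigraph). -/
structure ProperClosedConvex (φ : E → EReal) : Prop where
  ne_bot : ∀ x, φ x ≠ ⊥
  exists_ne_top : ∃ x, φ x ≠ ⊤
  lsc : LowerSemicontinuous φ
  convex : Convex ℝ {p : E × ℝ | φ p.1 ≤ (p.2 : EReal)}

/-- The objective `z ↦ α φ(z) + ½ ‖x - z‖²` of the proximal problem of `α φ` at `x`. -/
def proxObjective (α : ℝ) (φ : E → EReal) (x z : E) : EReal :=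
  (α : EReal) * φ z + ((1 / 2 * ‖x - z‖ ^ 2 : ℝ) : EReal)

/-- The proximal mapping `prox_{α φ}`: the (for `α > 0` and `φ` proper, closed and convex, unique)
minimizer of the proximal objective. -/
def prox (α : ℝ) (φ : E → EReal) (x : E) : E :=
  Classical.epsilon fun p => ∀ z, proxObjective α φ x p ≤ proxObjective α φ x z

/-- The Moreau envelope `env_{α φ}`: the minimal value of the proximal objective. -/
def moreauEnv (α : ℝ) (φ : E → EReal) (x : E) : ℝ :=
  (⨅ z, proxObjective α φ x z).toReal

/-- The convex conjugate of a real-valued function, with values in `(-∞, ∞]`. -/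
def conj (f : E → ℝ) (z : E) : EReal :=
  ⨆ x, ((inner ℝ z x - f x : ℝ) : EReal)

/-- The interior of the effective domain of the conjugate. -/
def conjDomInt (f : E → ℝ) : Set E := interior {z | conj f z < ⊤}

/-- The conjugate as a real-valued function; meaningful on its effective domain. -/
def conjReal (f : E → ℝ) (z : E) : ℝ := (conj f z).toReal

variable [CompleteSpace E]

/-- The gradient of the conjugate; meaningful on the interior of the effective domain. -/
def gradConj (f : E → ℝ) (z : E) : E := gradient (conjReal f) z

/-- The conjugate of `f` is essentially differentiable: the interior `C` of its domain is nonempty,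
it is differentiable on `C`, and the norm of its gradient blows up along every sequence in `C`
that converges to a boundary point of `C`. -/
def ConjEssentiallyDifferentiable (f : E → ℝ) : Prop :=
  (conjDomInt f).Nonempty ∧ (∀ z ∈ conjDomInt f, DifferentiableAt ℝ (conjReal f) z) ∧
    ∀ (u : ℕ → E) (z : E), (∀ k, u k ∈ conjDomInt f) → z ∈ frontier (conjDomInt f) →
      Tendsto u atTop (𝓝 z) → Tendsto (fun k => ‖gradConj f (u k)‖) atTop atTop

end Basic

/-! ### The conjugate gradient method -/

section CG

variable {H : Type*} [NormedAddCommGroup H] [InnerProductSpace ℝ H]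

/-- Current approximate solution, residual and search direction. -/
structure CGState (H : Type*) where
  sol : H
  res : H
  dir : H

/-- The conjugate gradient method for `T d = rhs`, started at `d = 0`. -/
def cg (T : H →L[ℝ] H) (rhs : H) : ℕ → CGState H
  | 0 => ⟨0, rhs, rhs⟩
  | k + 1 =>
    let s := cg T rhs k
    let a : ℝ := ‖s.res‖ ^ 2 / inner ℝ s.dir (T s.dir)
    let r : H := s.res - a • T s.dir
    ⟨s.sol + a • s.dir, r, r + (‖r‖ ^ 2 / ‖s.res‖ ^ 2) • s.dir⟩

end CG

/-! ### The subproblem -/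

section Sub

variable {E : Type*} [NormedAddCommGroup E] [InnerProductSpace ℝ E] [CompleteSpace E]

/-- The space of stacked variables `ξ = (ξ₁, …, ξ_b)` with the Euclidean norm. -/
abbrev Stack (E : Type*) (b : ℕ) : Type _ := PiLp 2 (fun _ : Fin b => E)

/-- The operator `(1/b) [I, …, I]ᵀ` that maps `w` to `(w/b, …, w/b)`. -/
def avgOp (E : Type*) [NormedAddCommGroup E] [InnerProductSpace ℝ E] (b : ℕ) :
    E →L[ℝ] Stack E b :=
  ((PiLp.continuousLinearEquiv 2 ℝ (fun _ : Fin b => E)).symm :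
      (Fin b → E) →L[ℝ] Stack E b) ∘L
    ContinuousLinearMap.pi fun _ => (1 / (b : ℝ)) • ContinuousLinearMap.id ℝ E

/-- The block-diagonal operator `blkdiag(H₁, …, H_b)`. -/
def blkdiag {b : ℕ} (Hs : Fin b → E →L[ℝ] E) : Stack E b →L[ℝ] Stack E b :=
  ((PiLp.continuousLinearEquiv 2 ℝ (fun _ : Fin b => E)).symm :
      (Fin b → E) →L[ℝ] Stack E b) ∘L
    ContinuousLinearMap.pi fun i => Hs i ∘L PiLp.proj 2 (fun _ : Fin b => E) i

/-- The data of one subproblem: the smooth functions of the batch (in the variable that is being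
updated, the other one being fixed), the nonsmooth convex term, the step size `α`, the current
iterate and the variance reduction vector. -/
structure Subproblem (E : Type*) (b : ℕ) where
  loss : Fin b → E → ℝ
  reg : E → EReal
  α : ℝ
  center : E
  vhat : E

namespace Subproblem

variable {b : ℕ} (S : Subproblem E b)

/-- The domain of the system: the product of the interiors of the domains of the conjugates. -/
def domain : Set (Stack E b) := {ξ | ∀ i, ξ i ∈ conjDomInt (S.loss i)}

/-- The argument `center - vhat - α 𝒜ᵀ ξ = center - vhat - (α/b) ∑ ξᵢ` of the proximal mapping. -/
def arg (ξ : Stack E b) : E :=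
  S.center - S.vhat - S.α • (ContinuousLinearMap.adjoint (avgOp E b)) ξ

/-- The mapping `ℱ` of the nonlinear system `ℱ(ξ) = 0`. -/
def F (ξ : Stack E b) : Stack E b :=
  WithLp.toLp 2 fun i => gradConj (S.loss i) (ξ i) - prox S.α S.reg (S.arg ξ)

/-- The objective function `ℐ` of the line search. -/
def objective (ξ : Stack E b) : ℝ :=
  ∑ i, conjReal (S.loss i) (ξ i) + (b : ℝ) / (2 * S.α) * ‖S.arg ξ‖ ^ 2
    - (b : ℝ) / S.α * moreauEnv S.α S.reg (S.arg ξ)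

/-- The surrogate generalized differential of `ℱ` at `ξ`. -/
def surrogate (ξ : Stack E b) : Set (Stack E b →L[ℝ] Stack E b) :=
  {W | ∃ U ∈ clarkeJacobian (prox S.α S.reg) (S.arg ξ), ∃ Hs : Fin b → E →L[ℝ] E,
    (∀ i, Hs i ∈ clarkeJacobian (gradConj (S.loss i)) (ξ i)) ∧
    W = blkdiag Hs +
      (S.α * b) • (avgOp E b ∘L U ∘L ContinuousLinearMap.adjoint (avgOp E b))}

end Subproblem

/-! ### The globalized semismooth Newton method -/

/-- The parameters of the semismooth Newton method. -/
structure Params where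
  γ : ℝ
  ρ : ℝ
  τ₁ : ℝ
  τ₂ : ℝ
  τ : ℝ
  hγ : γ ∈ Ioo (0 : ℝ) (1 / 2)
  hρ : ρ ∈ Ioo (0 : ℝ) 1
  hτ₁ : τ₁ ∈ Ioo (0 : ℝ) 1
  hτ₂ : τ₂ ∈ Ioo (0 : ℝ) 1
  hτ : τ ∈ Ioc (0 : ℝ) 1

/-- The regularization parameter `η = τ₁ min {τ₂, ‖ℱ(ξ)‖}`. -/
def regParam {b : ℕ} (S : Subproblem E b) (P : Params) (ξ : Stack E b) : ℝ :=
  P.τ₁ * min P.τ₂ ‖S.F ξ‖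

/-- The regularized Newton matrix `W + η I`. -/
def newtonOp {b : ℕ} (S : Subproblem E b) (P : Params) (ξ : Stack E b)
    (W : Stack E b →L[ℝ] Stack E b) : Stack E b →L[ℝ] Stack E b :=
  W + regParam S P ξ • ContinuousLinearMap.id ℝ (Stack E b)

/-- `d` is an admissible inexact Newton direction at `ξ` for the matrix `W`: an iterate of the
conjugate gradient method for `(W + η I) d = -ℱ(ξ)` with
`‖(W + η I) d + ℱ(ξ)‖ ≤ min {η, ‖ℱ(ξ)‖ ^ (1+τ)}`. -/
def IsNewtonDirection {b : ℕ} (S : Subproblem E b) (P : Params) (ξ : Stack E b)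
    (W : Stack E b →L[ℝ] Stack E b) (d : Stack E b) : Prop :=
  (∃ k, d = (cg (newtonOp S P ξ W) (-S.F ξ) k).sol) ∧
    ‖newtonOp S P ξ W d + S.F ξ‖ ≤ min (regParam S P ξ) (‖S.F ξ‖ ^ (1 + P.τ))

/-- The exponents `l` for which the trial point `ξ + ρ ^ l d` lies in the domain and satisfies the
Armijo condition. -/
def armijoSet {b : ℕ} (S : Subproblem E b) (P : Params) (ξ d : Stack E b) : Set ℕ :=
  {l | ξ + P.ρ ^ l • d ∈ S.domain ∧
    S.objective (ξ + P.ρ ^ l • d) ≤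
      S.objective ξ + P.γ * P.ρ ^ l * inner ℝ (gradient S.objective ξ) d}

/-- The sequence `ξ`, with matrices `W`, directions `d` and line search exponents `ℓ`, is generated
by the semismooth Newton method with stopping tolerance `tol`. Once the stopping criterion holds,
the sequence is continued by its last element (and `W`, `d`, `ℓ` carry no information). -/
structure IsRun {b : ℕ} (S : Subproblem E b) (P : Params) (tol : ℝ) (ξ : ℕ → Stack E b)
    (W : ℕ → Stack E b →L[ℝ] Stack E b) (d : ℕ → Stack E b) (ℓ : ℕ → ℕ) : Prop where
  init : ξ 0 ∈ S.domain
  matrix : ∀ j, tol < ‖S.F (ξ j)‖ → W j ∈ S.surrogate (ξ j)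
  direction : ∀ j, tol < ‖S.F (ξ j)‖ → IsNewtonDirection S P (ξ j) (W j) (d j)
  lineSearch : ∀ j, tol < ‖S.F (ξ j)‖ → IsLeast (armijoSet S P (ξ j) (d j)) (ℓ j)
  update : ∀ j, tol < ‖S.F (ξ j)‖ → ξ (j + 1) = ξ j + P.ρ ^ ℓ j • d j
  halt : ∀ j, ‖S.F (ξ j)‖ ≤ tol → ξ (j + 1) = ξ j

/-- Q-superlinear convergence of `ξ` to `ξs`. -/
def ConvergesSuperlinearly {H : Type*} [NormedAddCommGroup H] (ξ : ℕ → H) (ξs : H) : Prop :=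
  Tendsto ξ atTop (𝓝 ξs) ∧ (fun j => ‖ξ (j + 1) - ξs‖) =o[atTop] fun j => ‖ξ j - ξs‖

/-- The estimate `‖ξ (j+1) - ξs‖ = O(‖ξ j - ξs‖ ^ p)`. -/
def ConvergesWithOrder {H : Type*} [NormedAddCommGroup H] (p : ℝ) (ξ : ℕ → H) (ξs : H) : Prop :=
  (fun j => ‖ξ (j + 1) - ξs‖) =O[atTop] fun j => ‖ξ j - ξs‖ ^ p

end Sub

/-! ### The minimax problem -/

/-- The functions of the finite-sum minimax problem
`min_x max_y φ(x) + (1/N) ∑ gᵢ(x) + (1/N) ∑ fᵢ(x,y) - (1/N) ∑ hᵢ(y) - ψ(y)`. -/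
structure Problem (n m N : ℕ) where
  g : Fin N → EuclideanSpace ℝ (Fin n) → ℝ
  h : Fin N → EuclideanSpace ℝ (Fin m) → ℝ
  f : Fin N → EuclideanSpace ℝ (Fin n) → EuclideanSpace ℝ (Fin m) → ℝ
  φ : EuclideanSpace ℝ (Fin n) → EReal
  ψ : EuclideanSpace ℝ (Fin m) → EReal

namespace Problem

variable {n m N : ℕ} (Q : Problem n m N)

/-- The function `x ↦ gᵢ(x) + fᵢ(x,y)` for fixed `y`. -/
def lossX (y : EuclideanSpace ℝ (Fin m)) (i : Fin N) (x : EuclideanSpace ℝ (Fin n)) : ℝ :=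
  Q.g i x + Q.f i x y

/-- The function `y ↦ hᵢ(y) - fᵢ(x,y)` for fixed `x`. -/
def lossY (x : EuclideanSpace ℝ (Fin n)) (i : Fin N) (y : EuclideanSpace ℝ (Fin m)) : ℝ :=
  Q.h i y - Q.f i x y

/-- `gᵢ`, `hᵢ` are convex, `fᵢ` is convex-concave, all are continuously differentiable with
Lipschitz continuous (partial) gradients, `gᵢ + fᵢ(·,y)` is strongly convex and `-hᵢ + fᵢ(x,·)`
strongly concave, with moduli independent of the fixed variable. -/
structure SmoothStronglyConvexConcave : Prop where
  g_smooth : ∀ i, ContDiff ℝ 1 (Q.g i)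
  h_smooth : ∀ i, ContDiff ℝ 1 (Q.h i)
  f_smooth : ∀ i, ContDiff ℝ 1
    (fun p : EuclideanSpace ℝ (Fin n) × EuclideanSpace ℝ (Fin m) => Q.f i p.1 p.2)
  g_convex : ∀ i, ConvexOn ℝ univ (Q.g i)
  h_convex : ∀ i, ConvexOn ℝ univ (Q.h i)
  f_convex : ∀ i y, ConvexOn ℝ univ (fun x => Q.f i x y)
  f_concave : ∀ i x, ConcaveOn ℝ univ (fun y => Q.f i x y)
  g_lip : ∀ i, ∃ L : ℝ, 0 < L ∧ ∀ x x',
    ‖gradient (Q.g i) x' - gradient (Q.g i) x‖ ≤ L * ‖x' - x‖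
  h_lip : ∀ i, ∃ L : ℝ, 0 < L ∧ ∀ y y',
    ‖gradient (Q.h i) y' - gradient (Q.h i) y‖ ≤ L * ‖y' - y‖
  f_lip : ∀ i, ∃ L : ℝ, 0 < L ∧ ∀ x x' y y',
    max ‖gradient (fun u => Q.f i u y') x' - gradient (fun u => Q.f i u y) x‖
        ‖gradient (fun w => Q.f i x' w) y' - gradient (fun w => Q.f i x w) y‖
      ≤ L * Real.sqrt (‖x' - x‖ ^ 2 + ‖y' - y‖ ^ 2)
  strongConvex : ∀ i, ∃ μ : ℝ, 0 < μ ∧ ∀ y,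
    StrongConvexOn univ μ (fun x => Q.g i x + Q.f i x y)
  strongConcave : ∀ i, ∃ μ : ℝ, 0 < μ ∧ ∀ x,
    StrongConcaveOn univ μ (fun y => -Q.h i y + Q.f i x y)

/-- The nonsmooth terms are proper, closed and convex. -/
structure ClosedConvexRegularizers : Prop where
  φ_convex : ProperClosedConvex Q.φ
  ψ_convex : ProperClosedConvex Q.ψ

/-- The proximal mappings are semismooth for every positive parameter. -/
structure SemismoothProx : Prop where
  φ_prox : ∀ α : ℝ, 0 < α → SemismoothOn (prox α Q.φ) univ
  ψ_prox : ∀ α : ℝ, 0 < α → SemismoothOn (prox α Q.ψ) univ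

/-- The conjugates of the smooth functions are essentially differentiable, with locally Lipschitz
continuous gradients on the interior of their domains. -/
structure RegularConjugates : Prop where
  essX : ∀ y i, ConjEssentiallyDifferentiable (Q.lossX y i)
  essY : ∀ x i, ConjEssentiallyDifferentiable (Q.lossY x i)
  lipX : ∀ y i, LocallyLipschitzOn (conjDomInt (Q.lossX y i)) (gradConj (Q.lossX y i))
  lipY : ∀ x i, LocallyLipschitzOn (conjDomInt (Q.lossY x i)) (gradConj (Q.lossY x i))

/-- The gradients of the conjugates are semismooth on the interior of the domains. -/
structure SemismoothConjugates : Prop where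
  semiX : ∀ y i, SemismoothOn (gradConj (Q.lossX y i)) (conjDomInt (Q.lossX y i))
  semiY : ∀ x i, SemismoothOn (gradConj (Q.lossY x i)) (conjDomInt (Q.lossY x i))

/-- The proximal mappings are `ν`-order semismooth for every positive parameter. -/
structure OrderSemismoothProx (ν : ℝ) : Prop where
  φ_prox : ∀ α : ℝ, 0 < α → OrderSemismoothOn ν (prox α Q.φ) univ
  ψ_prox : ∀ α : ℝ, 0 < α → OrderSemismoothOn ν (prox α Q.ψ) univ

/-- The gradients of the conjugates are `ν`-order semismooth. -/
structure OrderSemismoothConjugates (ν : ℝ) : Prop where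
  semiX : ∀ y i, OrderSemismoothOn ν (gradConj (Q.lossX y i)) (conjDomInt (Q.lossX y i))
  semiY : ∀ x i, OrderSemismoothOn ν (gradConj (Q.lossY x i)) (conjDomInt (Q.lossY x i))

/-- The subproblem in `x` for the batch `κ`, the fixed second variable `yFix`, the current iterate
`x` and the variance reduction vector `v`. -/
def subX {b : ℕ} (κ : Fin b → Fin N) (α : ℝ) (yFix : EuclideanSpace ℝ (Fin m))
    (x v : EuclideanSpace ℝ (Fin n)) : Subproblem (EuclideanSpace ℝ (Fin n)) b where
  loss i := Q.lossX yFix (κ i)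
  reg := Q.φ
  α := α
  center := x
  vhat := v

/-- The subproblem in `y` for the batch `κ`, the fixed first variable `xFix`, the current iterate
`y` and the variance reduction vector `v`. -/
def subY {b : ℕ} (κ : Fin b → Fin N) (α : ℝ) (xFix : EuclideanSpace ℝ (Fin n))
    (y v : EuclideanSpace ℝ (Fin m)) : Subproblem (EuclideanSpace ℝ (Fin m)) b where
  loss i := Q.lossY xFix (κ i)
  reg := Q.ψ
  α := α
  center := y
  vhat := v

end Problem

end SSN

end

/-! Each loss is strongly convex with Lipschitz gradient, so its conjugate is finite everywhere and
the conjugate's gradient, the inverse of the loss gradient, is Lipschitz and strongly monotone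
(`conj_of_stronglyConvex`). The domain is therefore the whole space. The proximal mapping is the
monotone, nonexpansive gradient of `½‖·‖² - env`. Hence `ℐ` is strongly convex with gradient `ℱ`,
which is Lipschitz and strongly monotone, and a contraction argument gives the unique zero.
Convexity, differentiability and Lipschitz bounds of such pairs are bundled in `SubgradientMap`;
Clarke Jacobians inherit symmetry and spectral bounds from them, so every surrogate matrix is
symmetric and uniformly positive definite (`Subproblem.exists_isRegular`).

Global convergence: a conjugate gradient iterate satisfies `⟨rhs, d⟩ = ⟨T d, d⟩` even when the
system is solved inexactly, so `d` is a descent direction. Armijo steps are bounded below, each step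
decreases `ℐ` by a multiple of `‖ℱ‖²`, and `ℐ` is bounded below, so `ℱ(ξ j) → 0`.

Local rate: applying `W + η I` to the error after a full step leaves the linearization error of `ℱ`,
a term in `η`, and the residual of the linear system. Semismoothness and the tolerances make all
three small.

Unit steps: `ℱ` need not be differentiable at the solution, so a Hessian expansion is unavailable.
Directional differentiability and the Lipschitz property make `ℱ` positively homogeneous to first
order, uniformly in the direction. With `e` the error at `ξ`, this yields `ℐ(ξ) - ℐ(ξs) = ½⟨ℱ(ξ), e⟩
+ o(‖e‖²)`. Since `e + d = o(‖e‖)`, the decrease is `-½⟨ℱ(ξ), d⟩ + o(‖e‖²)`, and `γ < 1/2` suffices.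
-/

namespace SSN

/-! ### Strongly monotone maps and gradients of convex functions. -/

section Gradient

variable {E : Type*} [NormedAddCommGroup E] [InnerProductSpace ℝ E]

/-- A zero of a Lipschitz continuous, strongly monotone map. -/
theorem exists_zero_of_stronglyMonotone [CompleteSpace E] {F : E → E} {c K : ℝ} (hc : 0 < c)
    (hmono : ∀ u v, c * ‖u - v‖ ^ 2 ≤ inner ℝ (F u - F v) (u - v))
    (hlip : ∀ u v, ‖F u - F v‖ ≤ K * ‖u - v‖) : ∃ u, F u = 0 := by
  -- The extra `c` makes `L > c`, so `1 - c²/L²` is nonnegative and less than one.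
  set L : ℝ := max K c + c with hL
  have hLc : c < L := by have := le_max_right K c; linarith
  have hL0 : 0 < L := hc.trans hLc
  have hlip' : ∀ u v, ‖F u - F v‖ ≤ L * ‖u - v‖ := fun u v =>
    (hlip u v).trans (by
      have := le_max_left K c
      exact mul_le_mul_of_nonneg_right (by linarith) (norm_nonneg _))
  -- This step minimizes the squared contraction bound `1 - 2tc + t²L²` of `u ↦ u - t F u`.
  set t : ℝ := c / L ^ 2 with ht
  have ht0 : 0 < t := by positivity
  have hq : 0 ≤ 1 - c ^ 2 / L ^ 2 := by
    rw [sub_nonneg, div_le_one (by positivity)]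
    exact pow_le_pow_left₀ hc.le hLc.le 2
  have key : ∀ u v, ‖(u - t • F u) - (v - t • F v)‖ ≤ √(1 - c ^ 2 / L ^ 2) * ‖u - v‖ := by
    intro u v
    refine (sq_le_sq₀ (norm_nonneg _) (by positivity)).1 ?_
    rw [mul_pow, Real.sq_sqrt hq]
    have e : (u - t • F u) - (v - t • F v) = (u - v) - t • (F u - F v) := by
      rw [smul_sub]; abel
    rw [e, norm_sub_sq_real, real_inner_smul_right, norm_smul, mul_pow, Real.norm_eq_abs, sq_abs,
      real_inner_comm]
    have h1 := hmono u v
    have h2 : ‖F u - F v‖ ^ 2 ≤ L ^ 2 * ‖u - v‖ ^ 2 := by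
      rw [← mul_pow]; exact pow_le_pow_left₀ (norm_nonneg _) (hlip' u v) 2
    have h3 : t ^ 2 * ‖F u - F v‖ ^ 2 ≤ t ^ 2 * (L ^ 2 * ‖u - v‖ ^ 2) := by gcongr
    have h4 : t * (c * ‖u - v‖ ^ 2) ≤ t * inner ℝ (F u - F v) (u - v) := by gcongr
    have h5 : t ^ 2 * (L ^ 2 * ‖u - v‖ ^ 2) = c ^ 2 / L ^ 2 * ‖u - v‖ ^ 2 := by
      rw [ht]; field_simp
    have h6 : t * (c * ‖u - v‖ ^ 2) = c ^ 2 / L ^ 2 * ‖u - v‖ ^ 2 := by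
      rw [ht]; field_simp
    linarith
  have hcontr : ContractingWith (√(1 - c ^ 2 / L ^ 2)).toNNReal
      (fun u => u - t • F u) := by
    refine ⟨?_, LipschitzWith.of_dist_le_mul fun u v => ?_⟩
    · rw [Real.toNNReal_lt_one, Real.sqrt_lt' one_pos]
      have : 0 < c ^ 2 / L ^ 2 := by positivity
      linarith
    · simpa [dist_eq_norm, Real.coe_toNNReal _ (Real.sqrt_nonneg _)] using key u v
  obtain ⟨u, hu, -⟩ := hcontr.exists_fixedPoint 0 (edist_ne_top _ _)
  refine ⟨u, ?_⟩
  have : t • F u = 0 := by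
    have h : u - t • F u = u := hu
    simpa using h
  exact (smul_eq_zero.1 this).resolve_left ht0.ne'

theorem eq_of_stronglyMonotone {F : E → E} {c : ℝ} (hc : 0 < c)
    (hmono : ∀ u v, c * ‖u - v‖ ^ 2 ≤ inner ℝ (F u - F v) (u - v)) {u v : E} (h : F u = F v) :
    u = v := by
  have := hmono u v
  rw [h, sub_self, inner_zero_left] at this
  have h2 : ‖u - v‖ ^ 2 ≤ 0 := by
    by_contra! h0
    exact absurd this (not_le.2 (mul_pos hc h0))
  rw [← sub_eq_zero, ← norm_eq_zero]
  exact pow_eq_zero_iff two_ne_zero |>.1 (le_antisymm h2 (sq_nonneg _))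

theorem norm_le_of_stronglyMonotone {F : E → E} {c : ℝ}
    (hmono : ∀ u v, c * ‖u - v‖ ^ 2 ≤ inner ℝ (F u - F v) (u - v)) (u v : E) :
    c * ‖u - v‖ ≤ ‖F u - F v‖ := by
  rcases (norm_nonneg (u - v)).eq_or_lt with h | h
  · rw [← h, mul_zero]; positivity
  · have := (hmono u v).trans (real_inner_le_norm _ _)
    rw [sq, ← mul_assoc] at this
    exact le_of_mul_le_mul_right this h

variable [CompleteSpace E]

/-- A function with a Lipschitz continuous selection of subgradients is differentiable. -/
theorem hasGradientAt_of_subgradient {q : E → ℝ} {P : E → E} {K : ℝ}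
    (hsub : ∀ u v, q u + inner ℝ (P u) (v - u) ≤ q v)
    (hlip : ∀ u v, ‖P u - P v‖ ≤ K * ‖u - v‖) (u : E) : HasGradientAt q (P u) u := by
  rw [hasGradientAt_iff_isLittleO]
  -- The subgradient inequalities at `u` and at `v` squeeze the remainder between `0` and `⟨P v - P
  -- u, v - u⟩`.
  have hbound : (fun v => q v - q u - inner ℝ (P u) (v - u)) =O[𝓝 u]
      fun v => ‖v - u‖ ^ 2 := by
    refine IsBigO.of_bound K (Eventually.of_forall fun v => ?_)
    have h1 := hsub u v
    have h2 := hsub v u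
    have h3 : inner ℝ (P v - P u) (v - u) ≤ K * ‖v - u‖ ^ 2 :=
      (real_inner_le_norm _ _).trans (by
        have := mul_le_mul_of_nonneg_right (hlip v u) (norm_nonneg (v - u))
        rw [sq]; linarith)
    have h4 : inner ℝ (P v) (u - v) = -inner ℝ (P v) (v - u) := by
      rw [← inner_neg_right, neg_sub]
    rw [inner_sub_left] at h3
    rw [Real.norm_of_nonneg (by linarith), Real.norm_of_nonneg (by positivity)]
    linarith
  refine hbound.trans_isLittleO ?_
  have h := (isLittleO_pow_id (𝕜 := ℝ) (n := 2) (by norm_num)).comp_tendsto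
    (show Tendsto (fun v : E => ‖v - u‖) (𝓝 u) (𝓝 0) by
      have : Continuous fun v : E => ‖v - u‖ := by fun_prop
      simpa using this.tendsto u)
  exact h.trans_isBigO (IsBigO.of_bound 1 (Eventually.of_forall fun v => by simp))

/-- The gradient inequality of a strongly convex function. -/
theorem strongConvexOn_gradient_le {f : E → ℝ} {μ : ℝ} {x g : E} (hf : StrongConvexOn univ μ f)
    (hg : HasGradientAt f g x) (y : E) :
    f x + inner ℝ g (y - x) + μ / 2 * ‖y - x‖ ^ 2 ≤ f y := by
  have hd : HasLineDerivAt ℝ f (inner ℝ g (y - x)) x (y - x) := by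
    simpa using (hasGradientAt_iff_hasFDerivAt.1 hg).hasLineDerivAt (y - x)
  have h1 := hd.tendsto_slope_zero_right
  -- Strong convexity on the segment from `x` to `y`, divided by `t`, bounds the difference quotient
  -- by this function; then `t ↓ 0`.
  have h2 : Tendsto (fun t : ℝ => f y - f x - (1 - t) * (μ / 2 * ‖y - x‖ ^ 2)) (𝓝[>] 0)
      (𝓝 (f y - f x - (1 - 0) * (μ / 2 * ‖y - x‖ ^ 2))) := by
    refine Tendsto.mono_left ?_ nhdsWithin_le_nhds
    exact (Continuous.tendsto (by fun_prop) 0)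
  have h3 := le_of_tendsto_of_tendsto h1 h2 (by
    filter_upwards [Ioo_mem_nhdsGT (zero_lt_one' ℝ)] with t ht
    have := hf.2 (mem_univ x) (mem_univ y) (sub_nonneg.2 ht.2.le) ht.1.le (by ring)
    have e : (1 - t) • x + t • y = x + t • (y - x) := by rw [smul_sub, sub_smul, one_smul]; abel
    rw [e] at this
    simp only [smul_eq_mul] at this ⊢
    rw [inv_mul_le_iff₀ ht.1, norm_sub_rev y x]
    nlinarith)
  linarith

theorem stronglyMonotone_of_strongConvexOn {f : E → ℝ} {μ : ℝ} {f' : E → E}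
    (hf : StrongConvexOn univ μ f) (hg : ∀ x, HasGradientAt f (f' x) x) (x y : E) :
    μ * ‖x - y‖ ^ 2 ≤ inner ℝ (f' x - f' y) (x - y) := by
  have h1 := strongConvexOn_gradient_le hf (hg x) y
  have h2 := strongConvexOn_gradient_le hf (hg y) x
  have h3 : inner ℝ (f' x) (y - x) = -inner ℝ (f' x) (x - y) := by
    rw [← inner_neg_right, neg_sub]
  rw [inner_sub_left]
  rw [norm_sub_rev y x] at h1
  linarith

end Gradient

/-! ### Bounds inherited by Clarke's generalized Jacobian. -/

section Clarke

variable {E : Type*} [NormedAddCommGroup E] [InnerProductSpace ℝ E]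
  {G : Type*} [NormedAddCommGroup G] [NormedSpace ℝ G]

/-- Closed convex conditions on derivatives carry over to Clarke's generalized Jacobian. -/
theorem clarkeJacobian_subset {F : E → G} {C : Set (E →L[ℝ] G)} (hC : Convex ℝ C)
    (hcl : IsClosed C) (h : ∀ u, DifferentiableAt ℝ F u → fderiv ℝ F u ∈ C) (x : E) :
    clarkeJacobian F x ⊆ C := by
  refine convexHull_min ?_ hC
  rintro M ⟨u, -, hd, hM⟩
  exact hcl.mem_of_tendsto hM (Eventually.of_forall fun k => h _ (hd k))

theorem norm_le_of_mem_clarkeJacobian {F : E → G} {K : ℝ} (hK : 0 ≤ K)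
    (hlip : ∀ u v, ‖F u - F v‖ ≤ K * ‖u - v‖) {x : E} {M : E →L[ℝ] G}
    (hM : M ∈ clarkeJacobian F x) : ‖M‖ ≤ K := by
  have hl : LipschitzWith K.toNNReal F := LipschitzWith.of_dist_le_mul fun u v => by
    simpa [dist_eq_norm, hK] using hlip u v
  have := clarkeJacobian_subset (F := F) (convex_closedBall 0 K) Metric.isClosed_closedBall
    (fun u _ => by simpa [hK] using norm_fderiv_le_of_lipschitz ℝ (x₀ := u) hl) x hM
  simpa using this

/-- For fixed `h` the condition cuts out a closed half-space of operators, and derivatives lie in it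
as limits of monotone difference quotients. -/
theorem inner_ge_of_mem_clarkeJacobian {F : E → E} {c : ℝ}
    (hmono : ∀ u v, c * ‖u - v‖ ^ 2 ≤ inner ℝ (F u - F v) (u - v)) {x : E} {M : E →L[ℝ] E}
    (hM : M ∈ clarkeJacobian F x) (h : E) : c * ‖h‖ ^ 2 ≤ inner ℝ (M h) h := by
  refine clarkeJacobian_subset (F := F) (C := {M | c * ‖h‖ ^ 2 ≤ inner ℝ (M h) h}) ?_ ?_ ?_ x hM
  · intro A hA B hB a b ha hb hab
    simp only [mem_ofPred_eq, add_apply, smul_apply,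
      inner_add_left, real_inner_smul_left] at *
    have h1 := mul_le_mul_of_nonneg_left hA ha
    have h2 := mul_le_mul_of_nonneg_left hB hb
    calc c * ‖h‖ ^ 2 = a * (c * ‖h‖ ^ 2) + b * (c * ‖h‖ ^ 2) := by rw [← add_mul, hab, one_mul]
      _ ≤ _ := add_le_add h1 h2
  · exact isClosed_le continuous_const (by fun_prop)
  · intro u hu
    have hd : HasLineDerivAt ℝ F (fderiv ℝ F u h) u h := hu.hasFDerivAt.hasLineDerivAt h
    have h1 := hd.tendsto_slope_zero_right.inner (𝕜 := ℝ) (tendsto_const_nhds (x := h))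
    refine ge_of_tendsto h1 ?_
    filter_upwards [self_mem_nhdsWithin] with t ht
    have ht : 0 < t := ht
    have := hmono (u + t • h) u
    rw [add_sub_cancel_left, norm_smul, mul_pow, Real.norm_eq_abs, sq_abs,
      real_inner_smul_right] at this
    rw [real_inner_smul_left, ← div_eq_inv_mul, le_div_iff₀ ht]
    refine le_of_mul_le_mul_left ?_ ht
    linarith

/-- A derivative of a gradient map is a second derivative, hence symmetric; symmetry is a closed
linear condition and survives limits and convex combinations. -/
theorem symm_of_mem_clarkeJacobian [CompleteSpace E] {q : E → ℝ} {P : E → E}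
    (hq : ∀ u, HasGradientAt q (P u) u) {x : E} {M : E →L[ℝ] E}
    (hM : M ∈ clarkeJacobian P x) (v w : E) : inner ℝ (M v) w = inner ℝ v (M w) := by
  refine clarkeJacobian_subset (F := P) (C := {M | inner ℝ (M v) w = inner ℝ v (M w)})
    ?_ ?_ ?_ x hM
  · intro A hA B hB a b ha hb hab
    simp only [mem_ofPred_eq, add_apply, smul_apply,
      inner_add_left, inner_add_right, real_inner_smul_left, real_inner_smul_right] at *
    rw [hA, hB]
  · exact isClosed_eq (by fun_prop) (by fun_prop)
  · intro u hu
    have h1 : ∀ y, HasFDerivAt q (innerSL ℝ (P y)) y := fun y =>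
      hasGradientAt_iff_hasFDerivAt.1 (hq y)
    have h2 : HasFDerivAt (fun y => innerSL ℝ (P y)) ((innerSL ℝ).comp (fderiv ℝ P u)) u :=
      (innerSL ℝ).hasFDerivAt.comp u hu.hasFDerivAt
    have := second_derivative_symmetric h1 h2 v w
    simp only [ContinuousLinearMap.comp_apply, innerSL_apply_apply] at this
    rw [mem_ofPred_eq, this, real_inner_comm]

end Clarke

/-- `P` is a selection of subgradients of `q` that is `K`-Lipschitz continuous and strongly monotone
with modulus `c` (monotone if `c = 0`). -/
structure SubgradientMap {E : Type*} [NormedAddCommGroup E] [InnerProductSpace ℝ E]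
    (q : E → ℝ) (P : E → E) (c K : ℝ) : Prop where
  sub : ∀ u v, q u + inner ℝ (P u) (v - u) ≤ q v
  mono : ∀ u v, c * ‖u - v‖ ^ 2 ≤ inner ℝ (P u - P v) (u - v)
  lip : ∀ u v, ‖P u - P v‖ ≤ K * ‖u - v‖

/-! ### Conjugates of smooth strongly convex functions. -/

section Conjugate

variable {E : Type*} [NormedAddCommGroup E] [InnerProductSpace ℝ E] [CompleteSpace E]

theorem SubgradientMap.hasGradientAt {q : E → ℝ} {P : E → E} {c K : ℝ}
    (h : SubgradientMap q P c K) (u : E) : HasGradientAt q (P u) u :=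
  hasGradientAt_of_subgradient h.sub h.lip u

/-- The conjugate of a strongly convex function with Lipschitz continuous gradient is finite
everywhere, and its gradient is Lipschitz continuous and strongly monotone. -/
theorem conj_of_stronglyConvex {f : E → ℝ} {μ L : ℝ} {f' : E → E} (hμ : 0 < μ) (hL : 0 < L)
    (hf : StrongConvexOn univ μ f) (hg : ∀ x, HasGradientAt f (f' x) x)
    (hlip : ∀ x y, ‖f' x - f' y‖ ≤ L * ‖x - y‖) :
    conjDomInt f = univ ∧ SubgradientMap (conjReal f) (gradConj f) (μ / L ^ 2) (1 / μ) := by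
  have hmono := stronglyMonotone_of_strongConvexOn hf hg
  -- The gradient is onto, since `f' - z` has a zero. Its inverse `X` attains the supremum in the
  -- conjugate and turns out to be the conjugate's gradient.
  have hX : ∀ z, ∃ x, f' x = z := fun z => by
    obtain ⟨x, hx⟩ := exists_zero_of_stronglyMonotone (F := fun x => f' x - z) hμ
      (fun u v => by simpa using hmono u v) (fun u v => by simpa using hlip u v)
    exact ⟨x, sub_eq_zero.1 hx⟩
  choose X hX using hX
  have hconj : ∀ z, conj f z = ((inner ℝ z (X z) - f (X z) : ℝ) : EReal) := fun z => by
    refine le_antisymm (iSup_le fun x => EReal.coe_le_coe_iff.2 ?_) (le_iSup_of_le (X z) le_rfl)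
    have h1 := strongConvexOn_gradient_le hf (hg (X z)) x
    rw [hX, inner_sub_right] at h1
    have : 0 ≤ μ / 2 * ‖x - X z‖ ^ 2 := by positivity
    linarith
  have hreal : ∀ z, conjReal f z = inner ℝ z (X z) - f (X z) := fun z => by
    rw [conjReal, hconj, EReal.toReal_coe]
  have hXlip : ∀ u v, ‖X u - X v‖ ≤ 1 / μ * ‖u - v‖ := fun u v => by
    have := norm_le_of_stronglyMonotone hmono (X u) (X v)
    rw [hX, hX] at this
    rw [one_div, ← div_eq_inv_mul, le_div_iff₀ hμ]
    linarith
  -- The modulus combines `μ‖X u - X v‖² ≤ ⟨u - v, X u - X v⟩` with `‖u - v‖ ≤ L‖X u - X v‖`.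
  have hXmono : ∀ u v, μ / L ^ 2 * ‖u - v‖ ^ 2 ≤ inner ℝ (X u - X v) (u - v) := fun u v => by
    have h1 := hmono (X u) (X v)
    have h2 := hlip (X u) (X v)
    rw [hX, hX] at h1 h2
    rw [real_inner_comm]
    refine le_trans ?_ h1
    have h3 : ‖u - v‖ ^ 2 ≤ L ^ 2 * ‖X u - X v‖ ^ 2 := by
      rw [← mul_pow]; exact pow_le_pow_left₀ (norm_nonneg _) h2 2
    rw [div_mul_eq_mul_div, div_le_iff₀ (by positivity)]
    have := mul_le_mul_of_nonneg_left h3 hμ.le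
    linarith
  have hsub : ∀ u v, conjReal f u + inner ℝ (X u) (v - u) ≤ conjReal f v := fun u v => by
    rw [hreal, hreal]
    have h1 := strongConvexOn_gradient_le hf (hg (X v)) (X u)
    rw [hX, inner_sub_right] at h1
    have : 0 ≤ μ / 2 * ‖X u - X v‖ ^ 2 := by positivity
    rw [inner_sub_right, real_inner_comm v, real_inner_comm u]
    linarith
  have hgrad : gradConj f = X := funext fun z =>
    (hasGradientAt_of_subgradient hsub hXlip z).gradient
  refine ⟨?_, ?_⟩
  · have : {z | conj f z < ⊤} = univ := eq_univ_of_forall fun z => by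
      rw [mem_ofPred_eq, hconj]; exact EReal.coe_lt_top _
    rw [conjDomInt, this, interior_univ]
  · rw [hgrad]; exact ⟨hsub, hXmono, hXlip⟩

end Conjugate

/-! ### The proximal mapping and the Moreau envelope. -/

section Prox

theorem proxObjective_coe {E : Type*} [NormedAddCommGroup E] {α : ℝ} {φ : E → EReal} {z : E} {s : ℝ}
    (h : φ z = s) (x : E) :
    proxObjective α φ x z = ((α * s + 1 / 2 * ‖x - z‖ ^ 2 : ℝ) : EReal) := by
  rw [proxObjective, h, EReal.coe_add, EReal.coe_mul α]

theorem proxObjective_top {E : Type*} [NormedAddCommGroup E] {α : ℝ} (hα : 0 < α)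
    {φ : E → EReal} {z : E} (h : φ z = ⊤) (x : E) :
    proxObjective α φ x z = ⊤ := by
  rw [proxObjective, h, EReal.coe_mul_top_of_pos hα, EReal.top_add_coe]

variable {E : Type*} [NormedAddCommGroup E] [InnerProductSpace ℝ E]

/-- An affine lower bound in terms of the distance to a point of the domain. -/
theorem ProperClosedConvex.exists_lower_bound [FiniteDimensional ℝ E] {φ : E → EReal}
    (hφ : ProperClosedConvex φ) :
    ∃ (z₀ : E) (r₀ m A : ℝ), φ z₀ = r₀ ∧ 0 ≤ A ∧
      ∀ (z : E) (s : ℝ), φ z ≤ s → m - A * ‖z - z₀‖ ≤ s := by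
  obtain ⟨z₀, hz₀⟩ := hφ.exists_ne_top
  obtain ⟨r₀, hr₀⟩ : ∃ r₀ : ℝ, φ z₀ = r₀ := ⟨_, (EReal.coe_toReal hz₀ (hφ.ne_bot z₀)).symm⟩
  -- Lower semicontinuity bounds `φ` below by `m` on the unit ball about `z₀`. A point at distance
  -- `D ≥ 1` is pulled back to that ball with weight `1/D`, and convexity turns `m` into a bound of
  -- slope `r₀ - m`.
  obtain ⟨w₀, -, hw₀⟩ := (hφ.lsc.lowerSemicontinuousOn _).exists_isMinOn
    ⟨z₀, Metric.mem_closedBall_self zero_le_one⟩ (isCompact_closedBall z₀ 1)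
  have hw₀' : φ w₀ ≤ r₀ := hr₀ ▸ hw₀ (Metric.mem_closedBall_self zero_le_one)
  obtain ⟨m, hm⟩ : ∃ m : ℝ, φ w₀ = m :=
    ⟨_, (EReal.coe_toReal (hw₀'.trans_lt (EReal.coe_lt_top _)).ne (hφ.ne_bot w₀)).symm⟩
  have hmr : m ≤ r₀ := EReal.coe_le_coe_iff.1 (hm ▸ hw₀')
  have hball : ∀ w (s : ℝ), ‖w - z₀‖ ≤ 1 → φ w ≤ s → m ≤ s := fun w s hw hs =>
    EReal.coe_le_coe_iff.1 (hm ▸ (hw₀ (mem_closedBall_iff_norm.2 hw)).trans hs)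
  refine ⟨z₀, r₀, m, r₀ - m, hr₀, by linarith, fun z s hs => ?_⟩
  rcases le_total ‖z - z₀‖ 1 with h | h
  · have := hball z s h hs
    nlinarith [norm_nonneg (z - z₀)]
  · set D := ‖z - z₀‖ with hD
    have hD0 : 0 < D := by linarith
    have hconv := hφ.convex (x := (z₀, r₀)) (y := (z, s)) hr₀.le hs (a := 1 - 1 / D) (b := 1 / D)
      (by rw [sub_nonneg, div_le_one hD0]; exact h) (by positivity) (by ring)
    have := hball ((1 - 1 / D) • z₀ + (1 / D) • z) ((1 - 1 / D) * r₀ + 1 / D * s) (by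
      have e : (1 - 1 / D) • z₀ + (1 / D) • z - z₀ = (1 / D) • (z - z₀) := by
        rw [smul_sub, sub_smul, one_smul]; abel
      rw [e, norm_smul, ← hD, Real.norm_of_nonneg (by positivity), one_div_mul_cancel hD0.ne'])
      (by simpa using hconv)
    have h2 := mul_le_mul_of_nonneg_left this hD0.le
    have h3 : D * ((1 - 1 / D) * r₀ + 1 / D * s) = (D - 1) * r₀ + s := by field_simp
    rw [h3] at h2
    linarith

/-- The real function `J` is minimized over the closed epigraph. The quadratic term beats the linear
lower bound on `φ`, so only a compact part of the epigraph matters. -/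
theorem ProperClosedConvex.exists_isMin_proxObjective [FiniteDimensional ℝ E] {φ : E → EReal}
    (hφ : ProperClosedConvex φ) {α : ℝ} (hα : 0 < α) (x : E) :
    ∃ p, ∀ z, proxObjective α φ x p ≤ proxObjective α φ x z := by
  obtain ⟨z₀, r₀, m, A, hr₀, hA, hlow⟩ := hφ.exists_lower_bound
  set J : E × ℝ → ℝ := fun p => α * p.2 + 1 / 2 * ‖x - p.1‖ ^ 2 with hJ
  set J₀ : ℝ := J (z₀, r₀) with hJ₀
  set C : ℝ := J₀ - α * m + α * A * ‖x - z₀‖ with hC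
  -- A point of the sublevel set at distance `D` from `x` has `D (D/2 - αA) ≤ C`. If `D > R`, the
  -- bracket is at least one and `D > |C|`, a contradiction.
  set R : ℝ := 2 * (α * A) + 2 + |C| with hR
  have hαA : 0 ≤ α * A := by positivity
  have hbound : ∀ (z : E) (s : ℝ), φ z ≤ s → J (z, s) ≤ J₀ →
      ‖z - x‖ ≤ R ∧ m - A * (R + ‖x - z₀‖) ≤ s ∧ s ≤ J₀ / α := by
    intro z s hs hJs
    have h1 := hlow z s hs
    have h2 : ‖z - z₀‖ ≤ ‖z - x‖ + ‖x - z₀‖ := norm_sub_le_norm_sub_add_norm_sub z x z₀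
    have h3 : m - A * (‖z - x‖ + ‖x - z₀‖) ≤ s := by
      have := mul_le_mul_of_nonneg_left h2 hA; linarith
    have hJs' : α * s + 1 / 2 * ‖z - x‖ ^ 2 ≤ J₀ := by rw [norm_sub_rev z x]; exact hJs
    have hD : ‖z - x‖ ≤ R := by
      by_contra! hlt
      have h4 := mul_le_mul_of_nonneg_left h3 hα.le
      have h5 : ‖z - x‖ * (‖z - x‖ / 2 - α * A) ≤ C := by rw [hC]; nlinarith
      have h6 : 1 + |C| / 2 ≤ ‖z - x‖ / 2 - α * A := by rw [hR] at hlt; linarith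
      have h7 : |C| < ‖z - x‖ := by
        rw [hR] at hlt; linarith
      have h8 : ‖z - x‖ * 1 ≤ ‖z - x‖ * (‖z - x‖ / 2 - α * A) := by
        gcongr
        have := abs_nonneg C
        linarith
      have := le_abs_self C
      linarith
    refine ⟨hD, ?_, ?_⟩
    · have := mul_le_mul_of_nonneg_left hD hA
      linarith
    · rw [le_div_iff₀ hα]
      have : 0 ≤ 1 / 2 * ‖z - x‖ ^ 2 := by positivity
      linarith
  have hclosed : IsClosed {p : E × ℝ | φ p.1 ≤ (p.2 : EReal)} :=
    hφ.lsc.isClosed_epigraph.preimage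
      (continuous_fst.prodMk (continuous_coe_real_ereal.comp continuous_snd))
  have hcomp : IsCompact ((Metric.closedBall x R ×ˢ Icc (m - A * (R + ‖x - z₀‖)) (J₀ / α)) ∩
      {p : E × ℝ | φ p.1 ≤ (p.2 : EReal)}) :=
    ((isCompact_closedBall x R).prod isCompact_Icc).inter_right hclosed
  have hmem : ∀ (z : E) (s : ℝ), φ z ≤ s → J (z, s) ≤ J₀ →
      (z, s) ∈ (Metric.closedBall x R ×ˢ Icc (m - A * (R + ‖x - z₀‖)) (J₀ / α)) ∩
        {p : E × ℝ | φ p.1 ≤ (p.2 : EReal)} := fun z s hs hJs => by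
    obtain ⟨h1, h2, h3⟩ := hbound z s hs hJs
    exact ⟨⟨mem_closedBall_iff_norm.2 h1, h2, h3⟩, hs⟩
  have hJc : Continuous J := by fun_prop
  obtain ⟨⟨p, r⟩, ⟨-, hpr⟩, hmin⟩ := hcomp.exists_isMinOn ⟨_, hmem z₀ r₀ hr₀.le le_rfl⟩
    hJc.continuousOn
  have hpr : φ p ≤ r := hpr
  have hmin' : ∀ (z : E) (s : ℝ), φ z ≤ s → J (p, r) ≤ J (z, s) := fun z s hs => by
    rcases le_total (J (z, s)) J₀ with h | h
    · exact hmin (hmem z s hs h)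
    · exact (hmin (hmem z₀ r₀ hr₀.le le_rfl)).trans h
  obtain ⟨r', hr'⟩ : ∃ r' : ℝ, φ p = r' :=
    ⟨_, (EReal.coe_toReal (hpr.trans_lt (EReal.coe_lt_top _)).ne (hφ.ne_bot p)).symm⟩
  have hr'r : r' ≤ r := EReal.coe_le_coe_iff.1 (hr' ▸ hpr)
  refine ⟨p, fun z => ?_⟩
  by_cases hz : φ z = ⊤
  · rw [proxObjective_top hα hz]; exact le_top
  · have hs : φ z = ((φ z).toReal : EReal) := (EReal.coe_toReal hz (hφ.ne_bot z)).symm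
    rw [proxObjective_coe hr', proxObjective_coe hs, EReal.coe_le_coe_iff]
    refine le_trans ?_ (hmin' z _ hs.le)
    change α * r' + _ ≤ α * r + _
    gcongr

/-- Transfers minimality from `EReal` to real numbers. Competitors are points `(z, s)` of the
epigraph, so that its convexity applies to them directly. -/
theorem ProperClosedConvex.prox_spec [FiniteDimensional ℝ E] {φ : E → EReal}
    (hφ : ProperClosedConvex φ) {α : ℝ} (hα : 0 < α) (x : E) :
    ∃ r : ℝ, φ (prox α φ x) = r ∧
      moreauEnv α φ x = α * r + 1 / 2 * ‖x - prox α φ x‖ ^ 2 ∧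
      (∀ (z : E) (s : ℝ), φ z ≤ s →
        α * r + 1 / 2 * ‖x - prox α φ x‖ ^ 2 ≤ α * s + 1 / 2 * ‖x - z‖ ^ 2) := by
  have hP : ∀ z, proxObjective α φ x (prox α φ x) ≤ proxObjective α φ x z :=
    Classical.epsilon_spec (hφ.exists_isMin_proxObjective hα x)
  have hreal : ∀ (z : E), φ z ≠ ⊤ → φ z = ((φ z).toReal : EReal) := fun z hz =>
    (EReal.coe_toReal hz (hφ.ne_bot z)).symm
  have hPtop : φ (prox α φ x) ≠ ⊤ := fun htop => by
    obtain ⟨z₀, hz₀⟩ := hφ.exists_ne_top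
    have := hP z₀
    rw [proxObjective_top hα htop, proxObjective_coe (hreal z₀ hz₀), top_le_iff] at this
    exact EReal.coe_ne_top _ this
  refine ⟨_, hreal _ hPtop, ?_, fun z s hs => ?_⟩
  · have : ⨅ z, proxObjective α φ x z = proxObjective α φ x (prox α φ x) :=
      le_antisymm (iInf_le _ _) (le_iInf hP)
    rw [moreauEnv, this, proxObjective_coe (hreal _ hPtop), EReal.toReal_coe]
  · have hz := hreal z (hs.trans_lt (EReal.coe_lt_top _)).ne
    have h1 := hP z
    rw [proxObjective_coe (hreal _ hPtop), proxObjective_coe hz, EReal.coe_le_coe_iff] at h1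
    have h2 : (φ z).toReal ≤ s := EReal.coe_le_coe_iff.1 (hz ▸ hs)
    have := mul_le_mul_of_nonneg_left h2 hα.le
    linarith

/-- The proximal mapping is firmly nonexpansive. -/
theorem ProperClosedConvex.prox_firmly_nonexpansive [FiniteDimensional ℝ E] {φ : E → EReal}
    (hφ : ProperClosedConvex φ) {α : ℝ} (hα : 0 < α) (u v : E) :
    ‖prox α φ u - prox α φ v‖ ^ 2 ≤ inner ℝ (prox α φ u - prox α φ v) (u - v) := by
  -- This is `x - p ∈ α ∂φ(p)`, obtained by comparing `p` with `p + t(z - p)` and letting `t ↓ 0`.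
  -- Adding it for `u` and `v`, each tested at the other's proximal point, gives the claim.
  have hvar : ∀ (x p z : E) (r s : ℝ), φ p = r → φ z = s →
      (∀ (z : E) (s : ℝ), φ z ≤ s →
        α * r + 1 / 2 * ‖x - p‖ ^ 2 ≤ α * s + 1 / 2 * ‖x - z‖ ^ 2) →
      α * r + inner ℝ (x - p) (z - p) ≤ α * s := by
    intro x p z r s hp hz hmin
    have hlim : Tendsto (fun t : ℝ => α * s - α * r + t / 2 * ‖z - p‖ ^ 2) (𝓝[>] 0)
        (𝓝 (α * s - α * r + 0 / 2 * ‖z - p‖ ^ 2)) :=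
      (Continuous.tendsto (by fun_prop) 0).mono_left nhdsWithin_le_nhds
    have := ge_of_tendsto (b := inner ℝ (x - p) (z - p)) hlim (by
      filter_upwards [Ioo_mem_nhdsGT (zero_lt_one' ℝ)] with t ht
      have hconv := hφ.convex (x := (p, r)) (y := (z, s)) hp.le hz.le (sub_nonneg.2 ht.2.le)
        ht.1.le (by ring)
      have h1 := hmin ((1 - t) • p + t • z) ((1 - t) * r + t * s) (by simpa using hconv)
      have e : x - ((1 - t) • p + t • z) = (x - p) - t • (z - p) := by
        rw [smul_sub, sub_smul, one_smul]; abel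
      rw [e, norm_sub_sq_real (x - p), norm_smul, mul_pow, Real.norm_eq_abs, sq_abs,
        real_inner_smul_right] at h1
      refine le_of_mul_le_mul_left ?_ ht.1
      linarith)
    linarith
  obtain ⟨r, hr, -, hu⟩ := hφ.prox_spec hα u
  obtain ⟨s, hs, -, hv⟩ := hφ.prox_spec hα v
  have h1 := hvar u _ _ r s hr hs hu
  have h2 := hvar v _ _ s r hs hr hv
  set p := prox α φ u
  set p' := prox α φ v
  rw [← real_inner_self_eq_norm_sq]
  simp only [inner_sub_left, inner_sub_right] at *
  have e1 := real_inner_comm u p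
  have e2 := real_inner_comm u p'
  have e3 := real_inner_comm v p
  have e4 := real_inner_comm v p'
  have e5 := real_inner_comm p p'
  linarith

/-- The proximal mapping is the gradient of `½ ‖·‖² - env`. -/
theorem ProperClosedConvex.subgradientMap_prox [FiniteDimensional ℝ E] {φ : E → EReal}
    (hφ : ProperClosedConvex φ) {α : ℝ} (hα : 0 < α) :
    SubgradientMap (fun u => 1 / 2 * ‖u‖ ^ 2 - moreauEnv α φ u) (prox α φ) 0 1 where
  sub u v := by
    obtain ⟨r, hr, hru, -⟩ := hφ.prox_spec hα u
    obtain ⟨s, hs, hsv, hv⟩ := hφ.prox_spec hα v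
    -- `prox u` competes in the minimum defining the envelope at `v`; expanding the squares leaves
    -- the subgradient inequality.
    have h1 := hv _ r hr.le
    rw [← hsv, norm_sub_sq_real] at h1
    rw [norm_sub_sq_real] at hru
    rw [inner_sub_right, real_inner_comm u, real_inner_comm v]
    linarith
  mono u v := by
    rw [zero_mul]
    exact (sq_nonneg _).trans (hφ.prox_firmly_nonexpansive hα u v)
  lip u v := by
    rw [one_mul]
    rcases (norm_nonneg (prox α φ u - prox α φ v)).eq_or_lt with h | h
    · rw [← h]; positivity
    · have := (hφ.prox_firmly_nonexpansive hα u v).trans (real_inner_le_norm _ _)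
      rw [sq] at this
      exact le_of_mul_le_mul_left this h

end Prox

/-! ### Orthogonality relations of the conjugate gradient method. -/

section ConjugateGradient

variable {H : Type*} [NormedAddCommGroup H] [InnerProductSpace ℝ H] (T : H →L[ℝ] H) (rhs : H)

/-- The step length of the conjugate gradient method. -/
noncomputable def cgStep (k : ℕ) : ℝ :=
  ‖(cg T rhs k).res‖ ^ 2 / inner ℝ (cg T rhs k).dir (T (cg T rhs k).dir)

theorem cg_sol_succ (k : ℕ) :
    (cg T rhs (k + 1)).sol = (cg T rhs k).sol + cgStep T rhs k • (cg T rhs k).dir := rfl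

theorem cg_res_succ (k : ℕ) :
    (cg T rhs (k + 1)).res = (cg T rhs k).res - cgStep T rhs k • T (cg T rhs k).dir := rfl

theorem cg_dir_succ (k : ℕ) :
    (cg T rhs (k + 1)).dir = (cg T rhs (k + 1)).res +
      (‖(cg T rhs (k + 1)).res‖ ^ 2 / ‖(cg T rhs k).res‖ ^ 2) • (cg T rhs k).dir := rfl

theorem cg_res_eq (k : ℕ) : (cg T rhs k).res = rhs - T (cg T rhs k).sol := by
  induction k with
  | zero => simp [cg]
  | succ k ih => rw [cg_res_succ, cg_sol_succ, map_add, map_smul, ih]; abel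

/-- Covers termination, so that the orthogonality relations hold for every index. -/
theorem cg_dir_eq_zero {k : ℕ} (h : (cg T rhs k).res = 0) : (cg T rhs k).dir = 0 := by
  cases k with
  | zero => exact h
  | succ k => rw [cg_dir_succ, h]; simp

variable {T}

/-- The relations must be proved together: the identity for `⟨res, dir⟩` shows that step lengths are
nonzero before termination and that each step makes the new residual orthogonal to the current
direction. -/
theorem cg_orthogonality (hsymm : ∀ u v, inner ℝ (T u) v = inner ℝ u (T v))
    (hpos : ∀ u, u ≠ 0 → 0 < inner ℝ u (T u)) (k : ℕ) :
    (∀ j < k, inner ℝ (cg T rhs k).res (cg T rhs j).dir = 0 ∧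
      inner ℝ (cg T rhs k).dir (T (cg T rhs j).dir) = 0) ∧
    ∀ j ≤ k, inner ℝ (cg T rhs j).res (cg T rhs j).dir = ‖(cg T rhs j).res‖ ^ 2 := by
  induction k with
  | zero =>
    refine ⟨by simp, fun j hj => ?_⟩
    obtain rfl := Nat.le_zero.1 hj
    exact real_inner_self_eq_norm_sq _
  | succ k ih =>
    obtain ⟨ih1, ih3⟩ := ih
    have hstep : ∀ j ≤ k, (cg T rhs j).res ≠ 0 → cgStep T rhs j ≠ 0 ∧
        cgStep T rhs j * inner ℝ (cg T rhs j).dir (T (cg T rhs j).dir) =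
          ‖(cg T rhs j).res‖ ^ 2 := by
      intro j hj hr
      have hr2 : ‖(cg T rhs j).res‖ ^ 2 ≠ 0 := by simpa using hr
      have hd : (cg T rhs j).dir ≠ 0 := fun h0 => hr2 (by rw [← ih3 j hj, h0, inner_zero_right])
      have := (hpos _ hd).ne'
      exact ⟨div_ne_zero hr2 this, div_mul_cancel₀ _ this⟩
    have h1 : ∀ j < k + 1, inner ℝ (cg T rhs (k + 1)).res (cg T rhs j).dir = 0 := by
      intro j hj
      rw [cg_res_succ, inner_sub_left, real_inner_smul_left, hsymm]
      rcases Nat.lt_succ_iff_lt_or_eq.1 hj with hj | rfl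
      · rw [(ih1 j hj).1, (ih1 j hj).2, mul_zero, sub_zero]
      · by_cases hr : (cg T rhs j).res = 0
        · simp [hr, cg_dir_eq_zero T rhs hr]
        · rw [ih3 j le_rfl, (hstep j le_rfl hr).2, sub_self]
    -- Each earlier residual is a combination of its direction and the preceding one.
    have hres : ∀ j < k + 1, inner ℝ (cg T rhs (k + 1)).res (cg T rhs j).res = 0 := by
      intro j hj
      cases j with
      | zero => exact h1 0 hj
      | succ j =>
        have := h1 (j + 1) hj
        rwa [cg_dir_succ, inner_add_right, real_inner_smul_right, h1 j (by omega), mul_zero,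
          add_zero] at this
    have h3 : inner ℝ (cg T rhs (k + 1)).res (cg T rhs (k + 1)).dir =
        ‖(cg T rhs (k + 1)).res‖ ^ 2 := by
      rw [cg_dir_succ, inner_add_right, real_inner_smul_right, h1 k k.lt_succ_self, mul_zero,
        add_zero, real_inner_self_eq_norm_sq]
    have h2 : ∀ j < k + 1, inner ℝ (cg T rhs (k + 1)).dir (T (cg T rhs j).dir) = 0 := by
      intro j hj
      by_cases hr : (cg T rhs j).res = 0
      · rw [cg_dir_eq_zero T rhs hr, map_zero, inner_zero_right]
      obtain ⟨ha, hab⟩ := hstep j (Nat.lt_succ_iff.1 hj) hr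
      -- Multiplying by the nonzero step length lets the recursion replace `T dir` by a difference
      -- of two residuals.
      refine (mul_eq_zero.1 ?_).resolve_left ha
      have e : cgStep T rhs j * inner ℝ (cg T rhs (k + 1)).res (T (cg T rhs j).dir) =
          -inner ℝ (cg T rhs (k + 1)).res (cg T rhs (j + 1)).res := by
        rw [cg_res_succ T rhs j, inner_sub_right, hres j hj, real_inner_smul_right]; ring
      rw [cg_dir_succ, inner_add_left, real_inner_smul_left, mul_add, e]
      rcases Nat.lt_succ_iff_lt_or_eq.1 hj with hj | rfl
      · rw [hres (j + 1) (by omega), (ih1 j hj).2]; simp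
      · rw [mul_left_comm, hab, real_inner_self_eq_norm_sq, div_mul_cancel₀ _ (by simpa using hr),
          neg_add_cancel]
    refine ⟨fun j hj => ⟨h1 j hj, h2 j hj⟩, fun j hj => ?_⟩
    rcases Nat.le_succ_iff.1 hj with hj | rfl
    · exact ih3 j hj
    · exact h3

/-- The residual of the conjugate gradient method is orthogonal to the iterate. -/
theorem cg_inner_sol (hsymm : ∀ u v, inner ℝ (T u) v = inner ℝ u (T v))
    (hpos : ∀ u, u ≠ 0 → 0 < inner ℝ u (T u)) (k : ℕ) :
    inner ℝ rhs (cg T rhs k).sol = inner ℝ (T (cg T rhs k).sol) (cg T rhs k).sol := by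
  -- The iterate is a combination of earlier directions, all orthogonal to the current residual.
  have : ∀ i ≤ k, inner ℝ (cg T rhs k).res (cg T rhs i).sol = 0 := by
    intro i hi
    induction i with
    | zero => simp [cg]
    | succ i ih =>
      rw [cg_sol_succ, inner_add_right, real_inner_smul_right, ih (by omega),
        ((cg_orthogonality rhs hsymm hpos k).1 i hi).1, mul_zero, add_zero]
  have h := this k le_rfl
  rwa [cg_res_eq, inner_sub_left, sub_eq_zero] at h

end ConjugateGradient

/-! ### Uniformity of directional derivatives. -/

section Directional

variable {E : Type*} [NormedAddCommGroup E] [InnerProductSpace ℝ E]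
  {G : Type*} [NormedAddCommGroup G] [NormedSpace ℝ G]

/-- A Lipschitz continuous, directionally differentiable map is, up to first order, positively
homogeneous, uniformly with respect to the direction. -/
theorem DirDifferentiableAt.eventually_homogeneous [FiniteDimensional ℝ E] {F : E → G} {K : ℝ}
    (hlip : ∀ u v, ‖F u - F v‖ ≤ K * ‖u - v‖) {x : E} (hF : DirDifferentiableAt F x) {ε : ℝ} (hε : 0 < ε) :
    ∀ᶠ s in 𝓝 (0 : E), ∀ t ∈ Icc (0 : ℝ) 1,
      ‖F (x + t • s) - F x - t • (F (x + s) - F x)‖ ≤ ε * ‖s‖ := by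
  set Q : ℝ → E → G := fun r h => r⁻¹ • (F (x + r • h) - F x) with hQ
  -- The quotients are equi-Lipschitz in the direction, so their pointwise convergence becomes
  -- uniform on the compact unit sphere.
  have hQlip : ∀ r, 0 < r → ∀ h h', ‖Q r h - Q r h'‖ ≤ K * ‖h - h'‖ := by
    intro r hr h h'
    rw [hQ]
    simp only
    rw [← smul_sub, norm_smul, norm_inv, Real.norm_of_nonneg hr.le, inv_mul_le_iff₀ hr]
    have := hlip (x + r • h) (x + r • h')
    rw [add_sub_add_left_eq_sub, ← smul_sub, norm_smul, Real.norm_of_nonneg hr.le] at this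
    rw [sub_sub_sub_cancel_right]
    linarith
  have hunif : ∀ᶠ r in 𝓝 (0 : ℝ), ∀ h ∈ Metric.sphere (0 : E) 1,
      0 < r → ∀ t ∈ Ioc (0 : ℝ) 1, ‖Q (t * r) h - Q r h‖ ≤ ε := by
    refine (isCompact_sphere (0 : E) 1).eventually_forall_of_forall_eventually fun h₀ _ => ?_
    obtain ⟨D, hD⟩ := hF h₀
    have h1 : ∀ᶠ r in 𝓝[>] (0 : ℝ), ‖Q r h₀ - D‖ < ε / 4 := by
      have := hD.eventually (Metric.ball_mem_nhds D (show 0 < ε / 4 by positivity))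
      simpa [dist_eq_norm] using this
    obtain ⟨δ, hδ, hδ'⟩ := mem_nhdsGT_iff_exists_Ioo_subset.1 h1
    have hδ : 0 < δ := hδ
    have h2 : ∀ᶠ h in 𝓝 h₀, K * ‖h - h₀‖ < ε / 4 := by
      have hc : Continuous fun h : E => K * ‖h - h₀‖ := by fun_prop
      exact (hc.tendsto h₀).eventually_lt_const (by simpa using by positivity)
    filter_upwards [(continuous_fst.tendsto ((0 : ℝ), h₀)).eventually (Iio_mem_nhds hδ),
      (continuous_snd.tendsto ((0 : ℝ), h₀)).eventually h2] with p hp1 hp2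
    intro hp0 t ht
    have hp1 : p.1 < δ := hp1
    have htp : 0 < t * p.1 := mul_pos ht.1 hp0
    have htp' : t * p.1 < δ := lt_of_le_of_lt (mul_le_of_le_one_left hp0.le ht.2) hp1
    have a1 : ‖Q (t * p.1) h₀ - D‖ < ε / 4 := hδ' ⟨htp, htp'⟩
    have a2 : ‖Q p.1 h₀ - D‖ < ε / 4 := hδ' ⟨hp0, hp1⟩
    have a3 := hQlip _ htp p.2 h₀
    have a4 := hQlip _ hp0 p.2 h₀
    have e : Q (t * p.1) p.2 - Q p.1 p.2 = (Q (t * p.1) p.2 - Q (t * p.1) h₀) -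
        (Q p.1 p.2 - Q p.1 h₀) + ((Q (t * p.1) h₀ - D) - (Q p.1 h₀ - D)) := by abel
    rw [e]
    refine (norm_add_le _ _).trans ?_
    have b1 := norm_sub_le (Q (t * p.1) p.2 - Q (t * p.1) h₀) (Q p.1 p.2 - Q p.1 h₀)
    have b2 := norm_sub_le (Q (t * p.1) h₀ - D) (Q p.1 h₀ - D)
    linarith
  have hnorm : Tendsto (fun s : E => ‖s‖) (𝓝 0) (𝓝 0) := by
    simpa using (continuous_norm (E := E)).tendsto 0
  filter_upwards [hnorm.eventually hunif] with s hs t ht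
  rcases eq_or_ne s 0 with rfl | hs0
  · simp
  have hr : 0 < ‖s‖ := norm_pos_iff.2 hs0
  rcases ht.1.eq_or_lt with rfl | ht0
  · simpa using by positivity
  have h1 := hs (‖s‖⁻¹ • s) (by simp [norm_smul, hr.ne']) hr t ⟨ht0, ht.2⟩
  have e : F (x + t • s) - F x - t • (F (x + s) - F x) =
      (t * ‖s‖) • (Q (t * ‖s‖) (‖s‖⁻¹ • s) - Q ‖s‖ (‖s‖⁻¹ • s)) := by
    rw [hQ]
    simp only
    rw [smul_sub (t * ‖s‖), smul_smul, smul_smul, smul_smul, smul_smul, mul_inv_cancel_right₀ hr.ne',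
      mul_inv_cancel₀ (mul_pos ht0 hr).ne', one_smul, mul_inv_cancel₀ hr.ne', one_smul]
  rw [e, norm_smul, Real.norm_of_nonneg (by positivity)]
  calc t * ‖s‖ * _ ≤ 1 * ‖s‖ * ε := by gcongr; exact ht.2
    _ = ε * ‖s‖ := by ring

end Directional

/-! ### First- and second-order estimates for the objective. -/

section Local

variable {H : Type*} [NormedAddCommGroup H] [InnerProductSpace ℝ H]
  {q : H → ℝ} {F : H → H} {c K : ℝ}

/-- The descent lemma with `K` in place of `K/2`; this follows from the subgradient inequality at
`v` without integration. -/
theorem SubgradientMap.le_quadratic (h : SubgradientMap q F c K) (u v : H) :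
    q v ≤ q u + inner ℝ (F u) (v - u) + K * ‖v - u‖ ^ 2 := by
  have h1 := h.sub v u
  have h2 : inner ℝ (F v - F u) (v - u) ≤ K * ‖v - u‖ ^ 2 :=
    (real_inner_le_norm _ _).trans (by
      have := mul_le_mul_of_nonneg_right (h.lip v u) (norm_nonneg (v - u))
      rw [sq]; linarith)
  rw [← neg_sub v u, inner_neg_right] at h1
  rw [inner_sub_left] at h2
  linarith

variable [CompleteSpace H]

/-- Second-order expansion at a point where the gradient vanishes and is nearly homogeneous. -/
theorem SubgradientMap.quadratic_expansion (h : SubgradientMap q F c K) {x s : H} {ε : ℝ}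
    (hhom : ∀ t ∈ Icc (0 : ℝ) 1, ‖F (x + t • s) - t • F (x + s)‖ ≤ ε * ‖s‖) :
    |q (x + s) - q x - 1 / 2 * inner ℝ (F (x + s)) s| ≤ ε * ‖s‖ ^ 2 := by
  -- Subtracting the quadratic model along the segment leaves a function whose derivative is at most
  -- `ε‖s‖²`; the mean value inequality then replaces a Hessian expansion.
  have hd : ∀ t ∈ Icc (0 : ℝ) 1, HasDerivWithinAt
      (fun t : ℝ => q (x + t • s) - t ^ 2 / 2 * inner ℝ (F (x + s)) s)
      (inner ℝ (F (x + t • s) - t • F (x + s)) s) (Icc 0 1) t := by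
    intro t _
    have h1 : HasDerivAt (fun t : ℝ => x + t • s) s t := by
      simpa using ((hasDerivAt_id t).smul_const s).const_add x
    have h2 : HasDerivAt (fun t : ℝ => q (x + t • s)) (inner ℝ (F (x + t • s)) s) t := by
      simpa [Function.comp_def] using
        (hasGradientAt_iff_hasFDerivAt.1 (h.hasGradientAt (x + t • s))).comp_hasDerivAt t h1
    have h3 : HasDerivAt (fun t : ℝ => t ^ 2 / 2 * inner ℝ (F (x + s)) s)
        (t * inner ℝ (F (x + s)) s) t := by
      have := (((hasDerivAt_id t).pow 2).div_const 2).mul_const (inner ℝ (F (x + s)) s)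
      simpa using this
    rw [inner_sub_left, real_inner_smul_left]
    exact (h2.sub h3).hasDerivWithinAt
  have := norm_image_sub_le_of_norm_deriv_le_segment_01' hd (C := ε * ‖s‖ ^ 2) (fun t ht =>
    (norm_inner_le_norm _ _).trans (by
      have := mul_le_mul_of_nonneg_right (hhom t ⟨ht.1, ht.2.le⟩) (norm_nonneg s)
      rw [sq]; linarith))
  rw [Real.norm_eq_abs] at this
  convert this using 2
  simp
  ring

end Local

/-! ### Convergence of the Newton method for regular subproblems. -/

section Newton

variable {E : Type*} [NormedAddCommGroup E] [InnerProductSpace ℝ E] [CompleteSpace E] {b : ℕ}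

/-- A subproblem on the whole space, for which `ℱ` is the strongly monotone, Lipschitz continuous
gradient of the line search objective, with uniformly positive definite, symmetric surrogates. -/
structure Subproblem.IsRegular (S : Subproblem E b) (c K : ℝ) : Prop where
  pos_c : 0 < c
  pos_K : 0 < K
  domain_eq : S.domain = univ
  grad : SubgradientMap S.objective S.F c K
  symm : ∀ ξ, ∀ W ∈ S.surrogate ξ, ∀ u v, inner ℝ (W u) v = inner ℝ u (W v)
  pos : ∀ ξ, ∀ W ∈ S.surrogate ξ, ∀ u, c * ‖u‖ ^ 2 ≤ inner ℝ (W u) u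
  bound : ∀ ξ, ∀ W ∈ S.surrogate ξ, ∀ u, ‖W u‖ ≤ K * ‖u‖

variable {S : Subproblem E b} {c K : ℝ} {P : Params} {ξ ξs d : Stack E b}
  {W : Stack E b →L[ℝ] Stack E b}

theorem regParam_nonneg : 0 ≤ regParam S P ξ :=
  mul_nonneg P.hτ₁.1.le (le_min P.hτ₂.1.le (norm_nonneg _))

theorem regParam_le_one : regParam S P ξ ≤ 1 :=
  mul_le_one₀ P.hτ₁.2.le (le_min P.hτ₂.1.le (norm_nonneg _)) ((min_le_left _ _).trans P.hτ₂.2.le)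

theorem regParam_le : regParam S P ξ ≤ P.τ₁ * ‖S.F ξ‖ :=
  mul_le_mul_of_nonneg_left (min_le_right _ _) P.hτ₁.1.le

theorem newtonOp_apply (u : Stack E b) : newtonOp S P ξ W u = W u + regParam S P ξ • u := rfl

namespace Subproblem.IsRegular

theorem newtonOp_symm (hS : S.IsRegular c K) (hW : W ∈ S.surrogate ξ) (u v : Stack E b) :
    inner ℝ (newtonOp S P ξ W u) v = inner ℝ u (newtonOp S P ξ W v) := by
  rw [newtonOp_apply, newtonOp_apply, inner_add_left, inner_add_right, real_inner_smul_left,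
    real_inner_smul_right, hS.symm ξ W hW]

theorem newtonOp_pos (hS : S.IsRegular c K) (hW : W ∈ S.surrogate ξ) (u : Stack E b) :
    c * ‖u‖ ^ 2 ≤ inner ℝ (newtonOp S P ξ W u) u := by
  rw [newtonOp_apply, inner_add_left, real_inner_smul_left, real_inner_self_eq_norm_sq]
  have h1 := hS.pos ξ W hW u
  have h2 := mul_nonneg (regParam_nonneg (S := S) (P := P) (ξ := ξ)) (sq_nonneg ‖u‖)
  linarith

theorem mul_norm_le_newtonOp (hS : S.IsRegular c K) (hW : W ∈ S.surrogate ξ) (u : Stack E b) :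
    c * ‖u‖ ≤ ‖newtonOp S P ξ W u‖ := by
  simpa using norm_le_of_stronglyMonotone (F := newtonOp S P ξ W) (fun u v => by
    rw [← map_sub]; exact hS.newtonOp_pos hW (u - v)) u 0

/-- The inexact Newton direction is a descent direction. -/
theorem descent (hS : S.IsRegular c K) (hW : W ∈ S.surrogate ξ)
    (hd : IsNewtonDirection S P ξ W d) : c * ‖d‖ ^ 2 ≤ -inner ℝ (S.F ξ) d := by
  obtain ⟨⟨k, rfl⟩, -⟩ := hd
  have h := cg_inner_sol (-S.F ξ) (T := newtonOp S P ξ W) (hS.newtonOp_symm hW) (fun u hu => by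
    rw [real_inner_comm]
    have : 0 < ‖u‖ := norm_pos_iff.2 hu
    have hc := hS.pos_c
    exact lt_of_lt_of_le (by positivity) (hS.newtonOp_pos hW u)) k
  rw [← inner_neg_left, h]
  exact hS.newtonOp_pos hW _

/-- The residual is at most `τ₁‖ℱ‖` with `τ₁ < 1`, so `d` cannot be much shorter than `ℱ`. This
turns the Armijo decrease into a multiple of `‖ℱ‖²`. -/
theorem norm_direction_ge (hS : S.IsRegular c K) (hW : W ∈ S.surrogate ξ)
    (hd : IsNewtonDirection S P ξ W d) : (1 - P.τ₁) * ‖S.F ξ‖ ≤ (K + 1) * ‖d‖ := by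
  have h1 := (hd.2.trans (min_le_left _ _)).trans regParam_le
  have h2 : ‖newtonOp S P ξ W d‖ ≤ (K + 1) * ‖d‖ := by
    rw [newtonOp_apply]
    refine (norm_add_le _ _).trans ?_
    rw [norm_smul, Real.norm_of_nonneg regParam_nonneg]
    have := mul_le_mul_of_nonneg_right (regParam_le_one (S := S) (P := P) (ξ := ξ))
      (norm_nonneg d)
    have := hS.bound ξ W hW d
    linarith
  have h3 := norm_sub_le (newtonOp S P ξ W d + S.F ξ) (newtonOp S P ξ W d)
  rw [add_sub_cancel_left] at h3
  linarith

/-- The error after a full inexact Newton step. -/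
theorem newton_error (hS : S.IsRegular c K) (hW : W ∈ S.surrogate ξ)
    (hd : IsNewtonDirection S P ξ W d) (ξs : Stack E b) :
    c * ‖ξ + d - ξs‖ ≤
      ‖S.F ξ - W (ξ - ξs)‖ + P.τ₁ * ‖S.F ξ‖ * ‖ξ - ξs‖ + ‖S.F ξ‖ ^ (1 + P.τ) := by
  have h1 := hd.2.trans (min_le_right _ _)
  refine (hS.mul_norm_le_newtonOp (P := P) hW _).trans ?_
  -- The three summands are the linearization error at `ξs`, the effect of the regularization, and
  -- the residual of the linear solve.
  have e : newtonOp S P ξ W (ξ + d - ξs) =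
      -(S.F ξ - W (ξ - ξs)) + regParam S P ξ • (ξ - ξs) + (newtonOp S P ξ W d + S.F ξ) := by
    have : ξ + d - ξs = (ξ - ξs) + d := by abel
    rw [this, map_add, newtonOp_apply (ξ - ξs)]; abel
  rw [e]
  refine (norm_add₃_le).trans ?_
  rw [norm_neg, norm_smul, Real.norm_of_nonneg regParam_nonneg]
  have := mul_le_mul_of_nonneg_right (regParam_le (S := S) (P := P) (ξ := ξ))
    (norm_nonneg (ξ - ξs))
  linarith

theorem norm_F_le (hS : S.IsRegular c K) (hz : S.F ξs = 0) (ξ : Stack E b) :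
    ‖S.F ξ‖ ≤ K * ‖ξ - ξs‖ := by
  simpa [hz] using hS.grad.lip ξ ξs

theorem mul_norm_sub_le (hS : S.IsRegular c K) (hz : S.F ξs = 0) (ξ : Stack E b) :
    c * ‖ξ - ξs‖ ≤ ‖S.F ξ‖ := by
  simpa [hz] using norm_le_of_stronglyMonotone hS.grad.mono ξ ξs

theorem gradient_objective (hS : S.IsRegular c K) (ξ : Stack E b) :
    gradient S.objective ξ = S.F ξ := (hS.grad.hasGradientAt ξ).gradient

/-- Sufficiently small steps satisfy the Armijo condition. -/
theorem mem_armijoSet (hS : S.IsRegular c K) (hW : W ∈ S.surrogate ξ)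
    (hd : IsNewtonDirection S P ξ W d) {l : ℕ} (hl : K * P.ρ ^ l ≤ c / 2) :
    l ∈ armijoSet S P ξ d := by
  refine ⟨hS.domain_eq ▸ mem_univ _, ?_⟩
  rw [hS.gradient_objective]
  have hρ : 0 < P.ρ ^ l := pow_pos P.hρ.1 l
  set t := P.ρ ^ l
  have h1 := hS.grad.le_quadratic ξ (ξ + t • d)
  rw [add_sub_cancel_left, norm_smul, real_inner_smul_right, Real.norm_of_nonneg hρ.le] at h1
  have h2 := hS.descent hW hd
  have h3 : K * (t * ‖d‖) ^ 2 ≤ t * (1 / 2 * (c * ‖d‖ ^ 2)) := by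
    have := mul_le_mul_of_nonneg_right hl (mul_nonneg hρ.le (sq_nonneg ‖d‖))
    calc K * (t * ‖d‖) ^ 2 = K * t * (t * ‖d‖ ^ 2) := by ring
      _ ≤ c / 2 * (t * ‖d‖ ^ 2) := this
      _ = _ := by ring
  -- Since `1 - γ ≥ 1/2`, the share of the decrease not claimed by the Armijo test pays for the
  -- quadratic term.
  have h4 : 1 / 2 * (c * ‖d‖ ^ 2) ≤ (1 - P.γ) * -inner ℝ (S.F ξ) d := by
    have hc := hS.pos_c
    have := P.hγ.2
    have : 0 ≤ c * ‖d‖ ^ 2 := by positivity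
    exact mul_le_mul (by linarith) h2 this (by linarith)
  have h5 := mul_le_mul_of_nonneg_left h4 hρ.le
  linarith

/-- If `l > 0`, the previous exponent was rejected, so its step exceeds `c/(2K)`; one factor `ρ` is
lost. -/
theorem step_ge (hS : S.IsRegular c K) (hW : W ∈ S.surrogate ξ)
    (hd : IsNewtonDirection S P ξ W d) {l : ℕ} (hl : IsLeast (armijoSet S P ξ d) l) :
    min 1 (P.ρ * (c / (2 * K))) ≤ P.ρ ^ l := by
  cases l with
  | zero => simp
  | succ l =>
    refine (min_le_right _ _).trans ?_
    by_contra! hlt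
    have hK := hS.pos_K
    have hρ := P.hρ.1
    rw [pow_succ', mul_lt_mul_iff_right₀ hρ, lt_div_iff₀ (by positivity)] at hlt
    have := hl.2 (hS.mem_armijoSet (l := l) hW hd (by linarith))
    omega

/-- The iterates converge from every starting point. -/
theorem tendsto_of_isRun (hS : S.IsRegular c K) (hz : S.F ξs = 0) {ξ : ℕ → Stack E b}
    {W : ℕ → Stack E b →L[ℝ] Stack E b} {d : ℕ → Stack E b} {ℓ : ℕ → ℕ}
    (hrun : IsRun S P 0 ξ W d ℓ) : Tendsto ξ atTop (𝓝 ξs) := by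
  have hc := hS.pos_c
  have hK := hS.pos_K
  have hρ := P.hρ.1
  have hγ := P.hγ.1
  have hτ₁ : 0 < 1 - P.τ₁ := sub_pos.2 P.hτ₁.2
  set t₁ := min 1 (P.ρ * (c / (2 * K))) with ht₁
  have ht₁0 : 0 < t₁ := lt_min one_pos (by positivity)
  -- Armijo factor, minimal step, curvature, and the squared lower bound on `‖d‖/‖ℱ‖`.
  set δ := P.γ * t₁ * c * ((1 - P.τ₁) / (K + 1)) ^ 2 with hδ
  have hδ0 : 0 < δ := by positivity
  have hdec : ∀ j, δ * ‖S.F (ξ j)‖ ^ 2 ≤ S.objective (ξ j) - S.objective (ξ (j + 1)) := by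
    intro j
    rcases (norm_nonneg (S.F (ξ j))).eq_or_lt with h0 | h0
    · rw [hrun.halt j h0.ge, ← h0]; simp
    have hW := hrun.matrix j h0
    have hd := hrun.direction j h0
    have hl := hrun.lineSearch j h0
    have h1 := hl.1.2
    rw [← hrun.update j h0, hS.gradient_objective] at h1
    have h2 := hS.step_ge hW hd hl
    have h3 := hS.descent hW hd
    have h4 := hS.norm_direction_ge hW hd
    have h5 : (1 - P.τ₁) / (K + 1) * ‖S.F (ξ j)‖ ≤ ‖d j‖ := by
      rw [div_mul_eq_mul_div, div_le_iff₀ (by positivity)]; linarith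
    have h6 : P.γ * t₁ * (c * ((1 - P.τ₁) / (K + 1) * ‖S.F (ξ j)‖) ^ 2) ≤
        P.γ * P.ρ ^ ℓ j * -inner ℝ (S.F (ξ j)) (d j) := by
      refine mul_le_mul (by gcongr) (le_trans (by gcongr) h3) (by positivity) (by positivity)
    rw [mul_pow] at h6
    rw [hδ]
    linarith
  have hanti : Antitone fun j => S.objective (ξ j) := antitone_nat_of_succ_le fun j => by
    have h1 := hdec j
    have h2 : 0 ≤ δ * ‖S.F (ξ j)‖ ^ 2 := by positivity
    linarith
  have hbdd : BddBelow (range fun j => S.objective (ξ j)) := by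
    refine ⟨S.objective ξs, ?_⟩
    rintro _ ⟨j, rfl⟩
    simpa [hz] using hS.grad.sub ξs (ξ j)
  have hlim := tendsto_atTop_ciInf hanti hbdd
  have hdiff := hlim.sub (hlim.comp (tendsto_add_atTop_nat 1))
  rw [sub_self] at hdiff
  have hdist : Tendsto (fun j => δ * c ^ 2 * ‖ξ j - ξs‖ ^ 2) atTop (𝓝 0) := by
    refine squeeze_zero (fun j => by positivity) (fun j => ?_) hdiff
    refine le_trans ?_ (hdec j)
    have h1 := pow_le_pow_left₀ (by positivity) (hS.mul_norm_sub_le hz (ξ j)) 2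
    rw [mul_assoc, ← mul_pow]
    gcongr
  have hne : δ * c ^ 2 ≠ 0 := by positivity
  have h2 := (hdist.const_mul (δ * c ^ 2)⁻¹).sqrt
  simp only [inv_mul_cancel_left₀ hne, mul_zero, Real.sqrt_zero, Real.sqrt_sq (norm_nonneg _)] at h2
  exact tendsto_iff_norm_sub_tendsto_zero.2 h2

/-- One full step near the solution. -/
theorem eventually_newton_error_le (hS : S.IsRegular c K) (hz : S.F ξs = 0) (P : Params)
    (hsemi : ∀ ε : ℝ, 0 < ε → ∀ᶠ ξ in 𝓝 ξs, ∀ W ∈ S.surrogate ξ,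
      ‖S.F ξ - W (ξ - ξs)‖ ≤ ε * ‖ξ - ξs‖) {ε : ℝ} (hε : 0 < ε) :
    ∀ᶠ ξ in 𝓝 ξs, ∀ W ∈ S.surrogate ξ, ∀ d, IsNewtonDirection S P ξ W d →
      ‖ξ + d - ξs‖ ≤ ε * ‖ξ - ξs‖ := by
  have hc := hS.pos_c
  have hK := hS.pos_K
  have hτ := P.hτ.1
  have hsmall : ∀ᶠ ξ in 𝓝 ξs,
      P.τ₁ * K * ‖ξ - ξs‖ + K ^ (1 + P.τ) * ‖ξ - ξs‖ ^ P.τ < c * ε / 2 := by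
    have hcont : Continuous fun ξ : Stack E b =>
        P.τ₁ * K * ‖ξ - ξs‖ + K ^ (1 + P.τ) * ‖ξ - ξs‖ ^ P.τ := by
      have : Continuous fun ξ : Stack E b => ‖ξ - ξs‖ ^ P.τ :=
        (Real.continuous_rpow_const hτ.le).comp (by fun_prop)
      fun_prop
    refine (hcont.tendsto ξs).eventually_lt_const ?_
    simp only [sub_self, norm_zero, mul_zero, Real.zero_rpow hτ.ne', add_zero]
    positivity
  filter_upwards [hsmall, hsemi (c * ε / 2) (by positivity)] with ξ h1 h2 W hW d hd
  have h3 := hS.newton_error hW hd ξs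
  have h4 := h2 W hW
  have hF := hS.norm_F_le hz ξ
  have h5 : P.τ₁ * ‖S.F ξ‖ * ‖ξ - ξs‖ ≤ P.τ₁ * (K * ‖ξ - ξs‖) * ‖ξ - ξs‖ := by
    have := P.hτ₁.1.le
    gcongr
  have h6 : ‖S.F ξ‖ ^ (1 + P.τ) ≤ K ^ (1 + P.τ) * ‖ξ - ξs‖ ^ P.τ * ‖ξ - ξs‖ := by
    refine (Real.rpow_le_rpow (norm_nonneg _) hF (by positivity)).trans ?_
    rw [Real.mul_rpow hK.le (norm_nonneg _), Real.rpow_add' (norm_nonneg _) (by positivity),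
      Real.rpow_one]
    exact le_of_eq (by ring)
  have h7 := mul_le_mul_of_nonneg_right h1.le (norm_nonneg (ξ - ξs))
  refine le_of_mul_le_mul_left ?_ hc
  linarith

/-- The error terms have orders `1 + ν`, `2` and `1 + τ`. Within distance one of `ξs` the smallest
exponent dominates, and `τ ≤ 1` excludes `2`. -/
theorem eventually_newton_error_order (hS : S.IsRegular c K) (hz : S.F ξs = 0) (P : Params)
    {ν C : ℝ} (hν : 0 < ν) (hsemi : ∀ᶠ ξ in 𝓝 ξs, ∀ W ∈ S.surrogate ξ,
      ‖S.F ξ - W (ξ - ξs)‖ ≤ C * ‖ξ - ξs‖ ^ (1 + ν)) :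
    ∃ C' : ℝ, ∀ᶠ ξ in 𝓝 ξs, ∀ W ∈ S.surrogate ξ, ∀ d, IsNewtonDirection S P ξ W d →
      ‖ξ + d - ξs‖ ≤ C' * ‖ξ - ξs‖ ^ (1 + min P.τ ν) := by
  have hc := hS.pos_c
  have hK := hS.pos_K
  have hτ := P.hτ.1
  have hτ₁ := P.hτ₁.1
  have hmin : 0 < min P.τ ν := lt_min hτ hν
  refine ⟨(|C| + P.τ₁ * K + K ^ (1 + P.τ)) / c, ?_⟩
  have hone : ∀ᶠ ξ in 𝓝 ξs, ‖ξ - ξs‖ < 1 := by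
    have hcont : Continuous fun ξ : Stack E b => ‖ξ - ξs‖ := by fun_prop
    exact (hcont.tendsto ξs).eventually_lt_const (by simp)
  filter_upwards [hone, hsemi] with ξ h1 h2 W hW d hd
  have h3 := hS.newton_error hW hd ξs
  have hF := hS.norm_F_le hz ξ
  have hpow : ∀ p, 1 + min P.τ ν ≤ p → ‖ξ - ξs‖ ^ p ≤ ‖ξ - ξs‖ ^ (1 + min P.τ ν) := fun p hp =>
    Real.rpow_le_rpow_of_exponent_ge' (norm_nonneg _) h1.le (by positivity) hp
  have h4 : ‖S.F ξ - W (ξ - ξs)‖ ≤ |C| * ‖ξ - ξs‖ ^ (1 + min P.τ ν) := by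
    refine (h2 W hW).trans (mul_le_mul (le_abs_self C) (hpow _ ?_) (by positivity) (abs_nonneg C))
    linarith [min_le_right P.τ ν]
  have h5 : P.τ₁ * ‖S.F ξ‖ * ‖ξ - ξs‖ ≤ P.τ₁ * K * ‖ξ - ξs‖ ^ (1 + min P.τ ν) := by
    calc P.τ₁ * ‖S.F ξ‖ * ‖ξ - ξs‖ ≤ P.τ₁ * (K * ‖ξ - ξs‖) * ‖ξ - ξs‖ := by gcongr
      _ = P.τ₁ * K * ‖ξ - ξs‖ ^ (2 : ℝ) := by rw [Real.rpow_two]; ring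
      _ ≤ _ := mul_le_mul_of_nonneg_left
        (hpow 2 (by linarith [min_le_left P.τ ν, P.hτ.2])) (by positivity)
  have h6 : ‖S.F ξ‖ ^ (1 + P.τ) ≤ K ^ (1 + P.τ) * ‖ξ - ξs‖ ^ (1 + min P.τ ν) := by
    refine (Real.rpow_le_rpow (norm_nonneg _) hF (by positivity)).trans ?_
    rw [Real.mul_rpow hK.le (norm_nonneg _)]
    exact mul_le_mul_of_nonneg_left (hpow (1 + P.τ) (by linarith [min_le_left P.τ ν]))
      (by positivity)
  rw [div_mul_eq_mul_div, le_div_iff₀ hc]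
  linarith

/-- Near the solution the unit step satisfies the Armijo condition. -/
theorem eventually_unit_step [FiniteDimensional ℝ E] (hS : S.IsRegular c K) (hz : S.F ξs = 0)
    (P : Params) (hdir : DirDifferentiableAt S.F ξs)
    (hsemi : ∀ ε : ℝ, 0 < ε → ∀ᶠ ξ in 𝓝 ξs, ∀ W ∈ S.surrogate ξ,
      ‖S.F ξ - W (ξ - ξs)‖ ≤ ε * ‖ξ - ξs‖) :
    ∀ᶠ ξ in 𝓝 ξs, ∀ W ∈ S.surrogate ξ, ∀ d, IsNewtonDirection S P ξ W d →
      0 ∈ armijoSet S P ξ d := by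
  have hc := hS.pos_c
  have hK := hS.pos_K
  have hγ : 0 < 1 / 2 - P.γ := sub_pos.2 P.hγ.2
  -- The bound `1/2` forces `‖d‖ ≥ ½‖e‖`; the other keeps the total error `(1 + 2K)ε‖e‖²` below `(½
  -- - γ)c‖d‖²`.
  set ε : ℝ := min (1 / 2) ((1 / 2 - P.γ) * c / (4 * (1 + 2 * K))) with hε
  have hε0 : 0 < ε := lt_min (by norm_num) (by positivity)
  have hε1 : ε ≤ 1 / 2 := min_le_left _ _
  have hε2 : (1 + 2 * K) * ε ≤ (1 / 2 - P.γ) * (c / 4) := by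
    have := min_le_right (1 / 2) ((1 / 2 - P.γ) * c / (4 * (1 + 2 * K)))
    rw [← hε, le_div_iff₀ (by positivity)] at this
    linarith
  have hsub : Tendsto (fun ξ : Stack E b => ξ - ξs) (𝓝 ξs) (𝓝 0) := by
    have hcont : Continuous fun ξ : Stack E b => ξ - ξs := by fun_prop
    simpa using hcont.tendsto ξs
  filter_upwards [hsub.eventually (hdir.eventually_homogeneous hS.grad.lip hε0),
    hS.eventually_newton_error_le hz P hsemi hε0] with ξ h1 h2 W hW d hd
  refine ⟨hS.domain_eq ▸ mem_univ _, ?_⟩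
  rw [hS.gradient_objective, pow_zero, one_smul, mul_one]
  have h3 := h2 W hW d hd
  have hexp := hS.grad.quadratic_expansion (x := ξs) (s := ξ - ξs) (ε := ε) (fun t ht => by
    simpa [hz] using h1 t ht)
  rw [add_sub_cancel] at hexp
  set e := ξ - ξs with he
  have h4 : S.objective (ξ + d) ≤ S.objective ξs + K * (ε * ‖e‖) ^ 2 := by
    have := hS.grad.le_quadratic ξs (ξ + d)
    rw [hz, inner_zero_left, add_zero] at this
    refine this.trans ?_
    gcongr
  have h5 : K * (ε * ‖e‖) ^ 2 ≤ K * ε * ‖e‖ ^ 2 := by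
    have : ε * ε ≤ 1 * ε := by gcongr; linarith
    calc K * (ε * ‖e‖) ^ 2 = K * (ε * ε) * ‖e‖ ^ 2 := by ring
      _ ≤ K * (1 * ε) * ‖e‖ ^ 2 := by gcongr
      _ = _ := by ring
  have h6 : -(K * ε * ‖e‖ ^ 2) ≤ inner ℝ (S.F ξ) (e + d) := by
    have e1 : e + d = ξ + d - ξs := by rw [he]; abel
    rw [e1]
    have : -(‖S.F ξ‖ * ‖ξ + d - ξs‖) ≤ inner ℝ (S.F ξ) (ξ + d - ξs) :=
      (abs_le.1 (abs_real_inner_le_norm _ _)).1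
    refine le_trans ?_ this
    rw [neg_le_neg_iff]
    calc ‖S.F ξ‖ * ‖ξ + d - ξs‖ ≤ K * ‖e‖ * (ε * ‖e‖) := by
          have := hS.norm_F_le hz ξ
          gcongr
      _ = _ := by ring
  have h7 : 1 / 4 * ‖e‖ ^ 2 ≤ ‖d‖ ^ 2 := by
    have e1 : ‖e‖ ≤ ‖ξ + d - ξs‖ + ‖d‖ := by
      have := norm_sub_le (ξ + d - ξs) d
      rwa [show ξ + d - ξs - d = e by rw [he]; abel] at this
    have e2 : 1 / 2 * ‖e‖ ≤ ‖d‖ := by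
      have := mul_le_mul_of_nonneg_right hε1 (norm_nonneg e)
      linarith
    calc 1 / 4 * ‖e‖ ^ 2 = (1 / 2 * ‖e‖) ^ 2 := by ring
      _ ≤ _ := by gcongr
  have h8 := hS.descent hW hd
  have h9 : (1 + 2 * K) * ε * ‖e‖ ^ 2 ≤ (1 / 2 - P.γ) * -inner ℝ (S.F ξ) d := by
    calc (1 + 2 * K) * ε * ‖e‖ ^ 2 ≤ (1 / 2 - P.γ) * (c / 4) * ‖e‖ ^ 2 := by gcongr
      _ = (1 / 2 - P.γ) * (c * (1 / 4 * ‖e‖ ^ 2)) := by ring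
      _ ≤ (1 / 2 - P.γ) * -inner ℝ (S.F ξ) d := by
        gcongr
        exact le_trans (by gcongr) h8
  rw [inner_add_right] at h6
  -- Altogether `ℐ(ξ + d) - ℐ(ξ) ≤ ½⟨ℱ(ξ), d⟩ + (1 + 3K/2)ε‖e‖²`, and `h9` absorbs the last term
  -- into `(½ - γ)` times the slope.
  have h10 := (abs_le.1 hexp).1
  have h11 : 0 ≤ K * ε * ‖e‖ ^ 2 := by positivity
  linarith

/-- Fast local convergence of the globalized method. -/
theorem convergence [FiniteDimensional ℝ E] (hS : S.IsRegular c K) (hz : S.F ξs = 0)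
    (hdir : DirDifferentiableAt S.F ξs)
    (hsemi : ∀ ε : ℝ, 0 < ε → ∀ᶠ ξ in 𝓝 ξs, ∀ W ∈ S.surrogate ξ,
      ‖S.F ξ - W (ξ - ξs)‖ ≤ ε * ‖ξ - ξs‖) {ξ : ℕ → Stack E b}
    {W : ℕ → Stack E b →L[ℝ] Stack E b} {d : ℕ → Stack E b} {ℓ : ℕ → ℕ}
    (hrun : IsRun S P 0 ξ W d ℓ) :
    ConvergesSuperlinearly ξ ξs ∧ (∀ᶠ j in atTop, S.F (ξ j) ≠ 0 → ℓ j = 0) ∧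
      ∀ ν : ℝ, 0 < ν → (∃ C : ℝ, ∀ᶠ ξ in 𝓝 ξs, ∀ W ∈ S.surrogate ξ,
        ‖S.F ξ - W (ξ - ξs)‖ ≤ C * ‖ξ - ξs‖ ^ (1 + ν)) →
        ConvergesWithOrder (1 + min P.τ ν) ξ ξs := by
  have hlim := hS.tendsto_of_isRun hz hrun
  have hunit : ∀ᶠ j in atTop, S.F (ξ j) ≠ 0 → ℓ j = 0 := by
    filter_upwards [hlim.eventually (hS.eventually_unit_step hz P hdir hsemi)] with j hj h0
    have h0 : 0 < ‖S.F (ξ j)‖ := norm_pos_iff.2 h0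
    exact Nat.le_zero.1 ((hrun.lineSearch j h0).2
      (hj _ (hrun.matrix j h0) _ (hrun.direction j h0)))
  have hstep : ∀ B : ℝ → ℝ, (∀ r, 0 ≤ r → 0 ≤ B r) → (∀ᶠ ξ in 𝓝 ξs, ∀ W ∈ S.surrogate ξ,
      ∀ d, IsNewtonDirection S P ξ W d → ‖ξ + d - ξs‖ ≤ B ‖ξ - ξs‖) →
      ∀ᶠ j in atTop, ‖ξ (j + 1) - ξs‖ ≤ B ‖ξ j - ξs‖ := by
    intro B hB hev
    filter_upwards [hlim.eventually hev, hunit] with j hj hj0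
    -- A stopped iterate is `ξs` itself by uniqueness of the zero; otherwise the update is a full
    -- step.
    by_cases h0 : S.F (ξ j) = 0
    · rw [hrun.halt j (by rw [h0, norm_zero]),
        eq_of_stronglyMonotone hS.pos_c hS.grad.mono (h0.trans hz.symm), sub_self, norm_zero]
      exact hB 0 le_rfl
    · have h0' : 0 < ‖S.F (ξ j)‖ := norm_pos_iff.2 h0
      rw [hrun.update j h0', hj0 h0, pow_zero, one_smul]
      exact hj _ (hrun.matrix j h0') _ (hrun.direction j h0')
  refine ⟨⟨hlim, isLittleO_iff.2 fun ε hε => ?_⟩, hunit, fun ν hν ⟨C, hC⟩ => ?_⟩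
  · simpa using hstep (fun r => ε * r) (fun r hr => by positivity)
      (hS.eventually_newton_error_le hz P hsemi hε)
  · obtain ⟨C', hC'⟩ := hS.eventually_newton_error_order hz P hν hC
    refine IsBigO.of_bound |C'| ?_
    have := hstep (fun r => |C'| * r ^ (1 + min P.τ ν)) (fun r hr => by positivity) (by
      filter_upwards [hC'] with ξ h W hW d hd
      exact (h W hW d hd).trans (by gcongr; exact le_abs_self C'))
    filter_upwards [this] with j hj
    rwa [norm_norm, Real.norm_of_nonneg (by positivity)]

end Subproblem.IsRegular

end Newton

theorem SubgradientMap.weaken {E : Type*} [NormedAddCommGroup E] [InnerProductSpace ℝ E]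
    {q : E → ℝ} {P : E → E} {c K c' K' : ℝ} (h : SubgradientMap q P c K) (hc : c' ≤ c)
    (hK : K ≤ K') : SubgradientMap q P c' K' where
  sub := h.sub
  mono u v := (mul_le_mul_of_nonneg_right hc (sq_nonneg _)).trans (h.mono u v)
  lip u v := (h.lip u v).trans (mul_le_mul_of_nonneg_right hK (norm_nonneg _))

/-! ### Regularity and semismoothness of the stacked system. -/

section Stack

variable {E : Type*} [NormedAddCommGroup E] {b : ℕ}

theorem norm_toLp_le_of_forall_le {w : Fin b → E} {r : ℝ} (hr : 0 ≤ r) (h : ∀ i, ‖w i‖ ≤ r) :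
    ‖(WithLp.toLp 2 w : Stack E b)‖ ≤ √b * r := by
  rw [← sq_le_sq₀ (norm_nonneg _) (by positivity), PiLp.norm_sq_eq_of_L2, mul_pow,
    Real.sq_sqrt (by positivity)]
  calc ∑ i, ‖w i‖ ^ 2 ≤ ∑ _i : Fin b, r ^ 2 :=
        Finset.sum_le_sum fun i _ => pow_le_pow_left₀ (norm_nonneg _) (h i) 2
    _ = b * r ^ 2 := by simp

theorem norm_toLp_le_mul {w : Fin b → E} {u : Stack E b} {K : ℝ} (hK : 0 ≤ K)
    (h : ∀ i, ‖w i‖ ≤ K * ‖u i‖) : ‖(WithLp.toLp 2 w : Stack E b)‖ ≤ K * ‖u‖ := by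
  rw [← sq_le_sq₀ (norm_nonneg _) (by positivity), PiLp.norm_sq_eq_of_L2, mul_pow,
    PiLp.norm_sq_eq_of_L2, Finset.mul_sum]
  refine Finset.sum_le_sum fun i _ => ?_
  rw [← mul_pow]
  exact pow_le_pow_left₀ (norm_nonneg _) (h i) 2

theorem mul_norm_sq_stack (c : ℝ) (u : Stack E b) : c * ‖u‖ ^ 2 = ∑ i, c * ‖u i‖ ^ 2 := by
  rw [PiLp.norm_sq_eq_of_L2, Finset.mul_sum]

variable [InnerProductSpace ℝ E]

theorem avgOp_apply (w : E) (i : Fin b) : avgOp E b w i = (1 / (b : ℝ)) • w := rfl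

theorem blkdiag_apply (Hs : Fin b → E →L[ℝ] E) (u : Stack E b) (i : Fin b) :
    blkdiag Hs u i = Hs i (u i) := rfl

variable [CompleteSpace E]

open ContinuousLinearMap in
theorem Subproblem.arg_sub (S : Subproblem E b) (ξ ζ : Stack E b) :
    S.arg ξ - S.arg ζ = -(S.α • adjoint (avgOp E b) (ξ - ζ)) := by
  rw [Subproblem.arg, Subproblem.arg, map_sub, smul_sub]; abel

/-- Multiplying by `b` undoes the averaging in `avgOp`. In this form the proximal part is `avgOp`
after `prox` after an affine map built from its adjoint, a gradient structure. -/
theorem Subproblem.F_eq (hb : 0 < b) (S : Subproblem E b) (ξ : Stack E b) :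
    S.F ξ = WithLp.toLp 2 (fun i => gradConj (S.loss i) (ξ i)) -
      (b : ℝ) • avgOp E b (prox S.α S.reg (S.arg ξ)) := by
  have hb' : (b : ℝ) ≠ 0 := by positivity
  ext1 i
  simp [Subproblem.F, avgOp_apply, smul_smul, hb']

open ContinuousLinearMap in
theorem Subproblem.inner_F (hb : 0 < b) (S : Subproblem E b) (ξ u : Stack E b) :
    inner ℝ (S.F ξ) u = ∑ i, inner ℝ (gradConj (S.loss i) (ξ i)) (u i) -
      b * inner ℝ (prox S.α S.reg (S.arg ξ)) (adjoint (avgOp E b) u) := by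
  rw [S.F_eq hb, inner_sub_left, real_inner_smul_left, adjoint_inner_right, PiLp.inner_apply]

open ContinuousLinearMap in
theorem inner_surrogate {U : E →L[ℝ] E} {Hs : Fin b → E →L[ℝ] E} (t : ℝ) (u v : Stack E b) :
    inner ℝ ((blkdiag Hs + t • (avgOp E b ∘L U ∘L adjoint (avgOp E b))) u) v =
      ∑ i, inner ℝ (Hs i (u i)) (v i) +
        t * inner ℝ (U (adjoint (avgOp E b) u)) (adjoint (avgOp E b) v) := by
  simp only [add_apply, smul_apply, comp_apply, inner_add_left, real_inner_smul_left,
    adjoint_inner_right]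
  rw [PiLp.inner_apply]
  rfl

/-- The dual system of a subproblem with strongly convex, smooth losses is regular. -/
theorem Subproblem.exists_isRegular [FiniteDimensional ℝ E] (hb : 0 < b) (S : Subproblem E b)
    (hα : 0 < S.α) (hreg : ProperClosedConvex S.reg) {c K : ℝ} (hc : 0 < c) (hK : 0 < K)
    (hdom : ∀ i, conjDomInt (S.loss i) = univ)
    (hloss : ∀ i, SubgradientMap (conjReal (S.loss i)) (gradConj (S.loss i)) c K) :
    S.IsRegular c (K + S.α * b * ‖avgOp E b‖ ^ 2) := by
  have hP := hreg.subgradientMap_prox hα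
  have hb' : (0 : ℝ) < b := by positivity
  set A := avgOp E b with hA
  have hA' : ∀ u, ‖ContinuousLinearMap.adjoint A u‖ ≤ ‖A‖ * ‖u‖ := fun u => by
    have := (ContinuousLinearMap.adjoint A).le_opNorm u
    rwa [LinearIsometryEquiv.norm_map] at this
  refine ⟨hc, by positivity, eq_univ_of_forall fun ξ i => hdom i ▸ mem_univ _,
    ⟨fun ξ ζ => ?_, fun ξ ζ => ?_, fun ξ ζ => ?_⟩, ?_, ?_, ?_⟩
  · have h1 : ∑ i, (conjReal (S.loss i) (ξ i) +
        inner ℝ (gradConj (S.loss i) (ξ i)) ((ζ - ξ) i)) ≤ ∑ i, conjReal (S.loss i) (ζ i) :=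
      Finset.sum_le_sum fun i _ => (hloss i).sub (ξ i) (ζ i)
    -- The nonsmooth part of `ℐ` is `(b/α)(½‖·‖² - env)` composed with `arg`, whose linear part is
    -- `-α` times the adjoint of `avgOp`; the factor `α` cancels and the proximal term of `ℱ`
    -- appears.
    have h2 := mul_le_mul_of_nonneg_left (hP.sub (S.arg ξ) (S.arg ζ))
      (show 0 ≤ (b : ℝ) / S.α by positivity)
    rw [Finset.sum_add_distrib] at h1
    rw [S.arg_sub, inner_neg_right, real_inner_smul_right] at h2
    rw [S.inner_F hb, Subproblem.objective, Subproblem.objective]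
    have e1 : ∀ x : E, (b : ℝ) / (2 * S.α) * ‖x‖ ^ 2 - b / S.α * moreauEnv S.α S.reg x =
        b / S.α * (1 / 2 * ‖x‖ ^ 2 - moreauEnv S.α S.reg x) := fun x => by field_simp
    rw [add_sub_assoc, add_sub_assoc, e1, e1]
    rw [mul_add, mul_neg, ← mul_assoc, div_mul_cancel₀ _ hα.ne'] at h2
    linarith
  · rw [inner_sub_left, S.inner_F hb, S.inner_F hb, mul_norm_sq_stack]
    have h1 : ∑ i, c * ‖(ξ - ζ) i‖ ^ 2 ≤ ∑ i, (inner ℝ (gradConj (S.loss i) (ξ i)) ((ξ - ζ) i) -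
        inner ℝ (gradConj (S.loss i) (ζ i)) ((ξ - ζ) i)) := by
      refine Finset.sum_le_sum fun i _ => ?_
      rw [← inner_sub_left]
      exact (hloss i).mono (ξ i) (ζ i)
    -- The proximal part only adds a nonnegative term, so the modulus `c` of the conjugates is kept.
    have h2 := hP.mono (S.arg ξ) (S.arg ζ)
    rw [zero_mul, S.arg_sub, inner_neg_right, real_inner_smul_right, inner_sub_left,
      neg_nonneg] at h2
    have h3 := nonpos_of_mul_nonpos_right h2 hα
    have h4 := mul_nonneg hb'.le (neg_nonneg.2 h3)
    rw [Finset.sum_sub_distrib] at h1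
    linarith
  · have e : S.F ξ - S.F ζ =
        WithLp.toLp 2 (fun i => gradConj (S.loss i) (ξ i) - gradConj (S.loss i) (ζ i)) -
          (b : ℝ) • A (prox S.α S.reg (S.arg ξ) - prox S.α S.reg (S.arg ζ)) := by
      rw [S.F_eq hb, S.F_eq hb, map_sub, smul_sub]
      ext1 i
      simp only [PiLp.sub_apply]
      abel
    rw [e]
    refine (norm_sub_le _ _).trans ?_
    have h1 := norm_toLp_le_mul (u := ξ - ζ) hK.le fun i => (hloss i).lip (ξ i) (ζ i)
    have h2 := hP.lip (S.arg ξ) (S.arg ζ)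
    rw [one_mul, S.arg_sub, norm_neg, norm_smul, Real.norm_of_nonneg hα.le] at h2
    have h3 : ‖(b : ℝ) • A (prox S.α S.reg (S.arg ξ) - prox S.α S.reg (S.arg ζ))‖ ≤
        b * (‖A‖ * (S.α * (‖A‖ * ‖ξ - ζ‖))) := by
      rw [norm_smul, Real.norm_of_nonneg hb'.le]
      gcongr
      refine (A.le_opNorm _).trans ?_
      gcongr
      refine h2.trans ?_
      gcongr
      exact hA' _
    linarith
  · rintro ξ W ⟨U, hU, Hs, hHs, rfl⟩ u v
    rw [inner_surrogate, real_inner_comm _ u, inner_surrogate,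
      symm_of_mem_clarkeJacobian hP.hasGradientAt hU]
    congr 1
    · exact Finset.sum_congr rfl fun i _ => by
        rw [symm_of_mem_clarkeJacobian (hloss i).hasGradientAt (hHs i), real_inner_comm]
    · rw [real_inner_comm]
  · rintro ξ W ⟨U, hU, Hs, hHs, rfl⟩ u
    rw [inner_surrogate, mul_norm_sq_stack]
    have h1 : ∑ i, c * ‖u i‖ ^ 2 ≤ ∑ i, inner ℝ (Hs i (u i)) (u i) :=
      Finset.sum_le_sum fun i _ => inner_ge_of_mem_clarkeJacobian (hloss i).mono (hHs i) (u i)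
    have h2 := inner_ge_of_mem_clarkeJacobian hP.mono hU (ContinuousLinearMap.adjoint A u)
    rw [zero_mul] at h2
    have h3 := mul_nonneg (mul_nonneg hα.le hb'.le) h2
    linarith
  · rintro ξ W ⟨U, hU, Hs, hHs, rfl⟩ u
    refine (norm_add_le _ _).trans ?_
    have h1 : ‖blkdiag Hs u‖ ≤ K * ‖u‖ := norm_toLp_le_mul hK.le fun i =>
      (Hs i).le_of_opNorm_le (norm_le_of_mem_clarkeJacobian hK.le (hloss i).lip (hHs i)) (u i)
    have hU' := norm_le_of_mem_clarkeJacobian zero_le_one hP.lip hU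
    have h3 : ‖(S.α * b) • A (U (ContinuousLinearMap.adjoint A u))‖ ≤
        S.α * b * (‖A‖ * (1 * (‖A‖ * ‖u‖))) := by
      rw [norm_smul, Real.norm_of_nonneg (by positivity)]
      gcongr
      refine (A.le_opNorm _).trans ?_
      gcongr
      refine (U.le_of_opNorm_le hU' _).trans ?_
      gcongr
      exact hA' _
    change ‖blkdiag Hs u‖ + ‖(S.α * b) • A (U (ContinuousLinearMap.adjoint A u))‖ ≤ _
    linarith

open ContinuousLinearMap in
-- Since `arg` is affine, a line through `ξ` maps to a line, and the difference quotients of the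
-- components converge separately.
theorem Subproblem.dirDifferentiableAt_F (hb : 0 < b) (S : Subproblem E b) {ξ : Stack E b}
    (hP : DirDifferentiableAt (prox S.α S.reg) (S.arg ξ))
    (hG : ∀ i, DirDifferentiableAt (gradConj (S.loss i)) (ξ i)) : DirDifferentiableAt S.F ξ := by
  intro h
  choose DG hDG using fun i => hG i (h i)
  obtain ⟨DP, hDP⟩ := hP (-(S.α • adjoint (avgOp E b) h))
  refine ⟨WithLp.toLp 2 DG - (b : ℝ) • avgOp E b DP, ?_⟩
  have h1 := ((PiLp.continuous_toLp 2 (fun _ : Fin b => E)).tendsto DG).comp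
    (tendsto_pi_nhds.2 hDG)
  have h2 := (((avgOp E b).continuous.tendsto DP).comp hDP).const_smul (b : ℝ)
  refine (h1.sub h2).congr fun t => ?_
  have e : S.arg (ξ + t • h) = S.arg ξ + t • -(S.α • adjoint (avgOp E b) h) := by
    have := S.arg_sub (ξ + t • h) ξ
    rw [add_sub_cancel_left, map_smul, sub_eq_iff_eq_add] at this
    rw [this, smul_neg, smul_comm t, add_comm]
  rw [S.F_eq hb, S.F_eq hb, e]
  simp only [Function.comp_apply, map_smul, map_sub]
  ext1 i
  simp only [PiLp.sub_apply, PiLp.smul_apply, PiLp.add_apply, smul_sub]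
  simp only [smul_comm (b : ℝ) t⁻¹]
  abel

open ContinuousLinearMap in
/-- The linearization error of `ℱ` in terms of those of its components. -/
theorem Subproblem.linearization_error_le (hb : 0 < b) (S : Subproblem E b) {ξ ζ : Stack E b}
    {U : E →L[ℝ] E} {Hs : Fin b → E →L[ℝ] E} {r r' : ℝ} (hr : 0 ≤ r)
    (hH : ∀ i, ‖gradConj (S.loss i) (ξ i) - gradConj (S.loss i) (ζ i) - Hs i (ξ i - ζ i)‖ ≤ r)
    (hU : ‖prox S.α S.reg (S.arg ξ) - prox S.α S.reg (S.arg ζ) - U (S.arg ξ - S.arg ζ)‖ ≤ r') :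
    ‖S.F ξ - S.F ζ - (blkdiag Hs + (S.α * b) •
        (avgOp E b ∘L U ∘L adjoint (avgOp E b))) (ξ - ζ)‖ ≤
      √b * r + b * ‖avgOp E b‖ * r' := by
  -- The error splits exactly into blockwise and proximal errors because `arg` is affine; no chain
  -- rule for Clarke Jacobians is needed.
  have e : S.F ξ - S.F ζ - (blkdiag Hs + (S.α * b) •
        (avgOp E b ∘L U ∘L adjoint (avgOp E b))) (ξ - ζ) =
      WithLp.toLp 2 (fun i => gradConj (S.loss i) (ξ i) - gradConj (S.loss i) (ζ i) -
        Hs i (ξ i - ζ i)) - (b : ℝ) • avgOp E b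
          (prox S.α S.reg (S.arg ξ) - prox S.α S.reg (S.arg ζ) - U (S.arg ξ - S.arg ζ)) := by
    rw [S.F_eq hb, S.F_eq hb, S.arg_sub, map_neg U, map_smul U]
    simp only [add_apply, smul_apply, comp_apply, map_sub (avgOp E b), map_neg (avgOp E b),
      map_smul (avgOp E b)]
    ext1 i
    simp only [PiLp.sub_apply, PiLp.smul_apply, PiLp.add_apply, PiLp.neg_apply, blkdiag_apply,
      smul_sub, smul_neg, mul_smul, smul_comm S.α (b : ℝ)]
    abel
  rw [e]
  refine (norm_sub_le _ _).trans (add_le_add (norm_toLp_le_of_forall_le hr hH) ?_)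
  rw [norm_smul, Real.norm_of_nonneg (by positivity), mul_assoc]
  gcongr
  exact (avgOp E b).le_opNorm_of_le hU

/-- Semismoothness of `ℱ` with respect to the surrogate differential, for a gauge `B` of the
linearization error. -/
theorem Subproblem.eventually_linearization_error_le (hb : 0 < b) (S : Subproblem E b)
    (ξs : Stack E b) {B : ℝ → ℝ} (hB0 : ∀ r, 0 ≤ r → 0 ≤ B r) (hB : MonotoneOn B (Ici 0))
    (hG : ∀ i, ∀ᶠ s in 𝓝 (0 : E), ∀ M ∈ clarkeJacobian (gradConj (S.loss i)) (ξs i + s),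
      ‖gradConj (S.loss i) (ξs i + s) - gradConj (S.loss i) (ξs i) - M s‖ ≤ B ‖s‖)
    (hP : ∀ᶠ s in 𝓝 (0 : E), ∀ M ∈ clarkeJacobian (prox S.α S.reg) (S.arg ξs + s),
      ‖prox S.α S.reg (S.arg ξs + s) - prox S.α S.reg (S.arg ξs) - M s‖ ≤ B ‖s‖) :
    ∀ᶠ ξ in 𝓝 ξs, ∀ W ∈ S.surrogate ξ, ‖S.F ξ - S.F ξs - W (ξ - ξs)‖ ≤
      √b * B ‖ξ - ξs‖ + b * ‖avgOp E b‖ * B (|S.α| * ‖avgOp E b‖ * ‖ξ - ξs‖) := by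
  have t1 : ∀ i, Tendsto (fun ξ : Stack E b => ξ i - ξs i) (𝓝 ξs) (𝓝 0) := fun i => by
    have : Continuous fun ξ : Stack E b => ξ i - ξs i := by fun_prop
    simpa using this.tendsto ξs
  have t2 : Tendsto (fun ξ : Stack E b => S.arg ξ - S.arg ξs) (𝓝 ξs) (𝓝 0) := by
    have : Continuous fun ξ : Stack E b => S.arg ξ - S.arg ξs := by
      simp only [S.arg_sub]; fun_prop
    simpa using this.tendsto ξs
  filter_upwards [eventually_all.2 fun i => (t1 i).eventually (hG i), t2.eventually hP]
    with ξ h1 h2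
  rintro W ⟨U, hU, Hs, hHs, rfl⟩
  refine S.linearization_error_le hb (hB0 _ (norm_nonneg _)) (fun i => ?_) ?_
  · have := h1 i (Hs i) (by rw [add_sub_cancel]; exact hHs i)
    rw [add_sub_cancel] at this
    exact this.trans (hB (norm_nonneg _) (norm_nonneg _) (PiLp.norm_apply_le (ξ - ξs) i))
  · have := h2 U (by rw [add_sub_cancel]; exact hU)
    rw [add_sub_cancel] at this
    refine this.trans (hB (norm_nonneg _) (mem_Ici.2 (by positivity)) ?_)
    rw [S.arg_sub, norm_neg, norm_smul, Real.norm_eq_abs, mul_assoc]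
    gcongr
    refine ((ContinuousLinearMap.adjoint (avgOp E b)).le_opNorm _).trans_eq ?_
    rw [LinearIsometryEquiv.norm_map]

/-- Convergence of the globalized semismooth Newton method for one subproblem. -/
theorem Subproblem.newton_convergence [FiniteDimensional ℝ E] (hb : 0 < b) (S : Subproblem E b)
    (hα : 0 < S.α) (hreg : ProperClosedConvex S.reg)
    (hloss : ∀ i, ∃ c K : ℝ, 0 < c ∧ 0 < K ∧ conjDomInt (S.loss i) = univ ∧
      SubgradientMap (conjReal (S.loss i)) (gradConj (S.loss i)) c K)
    (hprox : SemismoothOn (prox S.α S.reg) univ)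
    (hsemi : ∀ i, SemismoothOn (gradConj (S.loss i)) (conjDomInt (S.loss i))) (P : Params) :
    ∃ ξs ∈ S.domain, S.F ξs = 0 ∧ (∀ ζ ∈ S.domain, S.F ζ = 0 → ζ = ξs) ∧
      ∀ ξ W d ℓ, IsRun S P 0 ξ W d ℓ →
        ConvergesSuperlinearly ξ ξs ∧ (∀ᶠ j in atTop, S.F (ξ j) ≠ 0 → ℓ j = 0) ∧
        ∀ ν : ℝ, 0 < ν → OrderSemismoothOn ν (prox S.α S.reg) univ →
          (∀ i, OrderSemismoothOn ν (gradConj (S.loss i)) (conjDomInt (S.loss i))) →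
          ConvergesWithOrder (1 + min P.τ ν) ξ ξs := by
  choose c K hc hK hdom hsub using hloss
  have hne : (Finset.univ : Finset (Fin b)).Nonempty := ⟨⟨0, hb⟩, Finset.mem_univ _⟩
  have hS := S.exists_isRegular hb hα hreg (c := Finset.univ.inf' hne c) (K := ∑ i, K i)
    ((Finset.lt_inf'_iff hne).2 fun i _ => hc i) (Finset.sum_pos (fun i _ => hK i) hne) hdom
    (fun i => (hsub i).weaken (Finset.inf'_le _ (Finset.mem_univ i))
      (Finset.single_le_sum (fun i _ => (hK i).le) (Finset.mem_univ i)))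
  obtain ⟨ξs, hz⟩ := exists_zero_of_stronglyMonotone hS.pos_c hS.grad.mono hS.grad.lip
  have hmem : ∀ i, ξs i ∈ conjDomInt (S.loss i) := fun i => hdom i ▸ mem_univ _
  refine ⟨ξs, hmem, hz, fun ζ _ hζ =>
    eq_of_stronglyMonotone hS.pos_c hS.grad.mono (hζ.trans hz.symm), fun ξ W d ℓ hrun => ?_⟩
  have hdir := S.dirDifferentiableAt_F hb (hprox.2 _ (mem_univ (S.arg ξs))).1
    (fun i => ((hsemi i).2 _ (hmem i)).1)
  set a := ‖avgOp E b‖ with ha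
  have hF : ∀ ε : ℝ, 0 < ε → ∀ᶠ ξ in 𝓝 ξs, ∀ W ∈ S.surrogate ξ,
      ‖S.F ξ - W (ξ - ξs)‖ ≤ ε * ‖ξ - ξs‖ := by
    intro ε hε
    -- Sum of the factors by which component errors enter the stacked error, plus one for
    -- positivity.
    set M : ℝ := √b + b * a * (|S.α| * a) + 1 with hM
    have hM0 : 0 < M := by positivity
    filter_upwards [S.eventually_linearization_error_le hb ξs (B := fun r => ε / M * r)
      (fun r hr => by positivity)
      (fun r _ r' _ h => mul_le_mul_of_nonneg_left h (by positivity))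
      (fun i => ((hsemi i).2 _ (hmem i)).2 _ (by positivity))
      ((hprox.2 _ (mem_univ _)).2 _ (by positivity))] with ξ h W hW
    have h1 := h W hW
    rw [hz, sub_zero] at h1
    refine h1.trans ?_
    calc √b * (ε / M * ‖ξ - ξs‖) + b * a * (ε / M * (|S.α| * a * ‖ξ - ξs‖))
        = ε / M * (M - 1) * ‖ξ - ξs‖ := by rw [hM]; ring
      _ ≤ ε / M * M * ‖ξ - ξs‖ := by gcongr; linarith
      _ = ε * ‖ξ - ξs‖ := by rw [div_mul_cancel₀ _ hM0.ne']
  obtain ⟨h1, h2, h3⟩ := hS.convergence hz hdir hF hrun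
  refine ⟨h1, h2, fun ν hν hPν hGν => h3 ν hν ?_⟩
  obtain ⟨CP, hCP⟩ := (hPν.2 _ (mem_univ (S.arg ξs))).2
  choose CG hCG using fun i => ((hGν i).2 _ (hmem i)).2
  -- A common nonnegative constant, so that `C r^(1+ν)` is a monotone gauge for all components.
  set C : ℝ := |CP| + ∑ i, |CG i| with hC
  have hCP' : CP ≤ C := (le_abs_self _).trans (le_add_of_nonneg_right (by positivity))
  have hCG' : ∀ i, CG i ≤ C := fun i => (le_abs_self _).trans
    ((Finset.single_le_sum (f := fun i => |CG i|) (fun i _ => abs_nonneg _)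
      (Finset.mem_univ i)).trans (le_add_of_nonneg_left (abs_nonneg _)))
  have hν' : 0 ≤ 1 + ν := by positivity
  refine ⟨√b * C + b * a * (C * (|S.α| * a) ^ (1 + ν)), ?_⟩
  filter_upwards [S.eventually_linearization_error_le hb ξs (B := fun r => C * r ^ (1 + ν))
    (fun r hr => by positivity)
    (fun r hr r' _ h => mul_le_mul_of_nonneg_left (Real.rpow_le_rpow hr h hν') (by positivity))
    (fun i => (hCG i).mono fun s h M hM => (h M hM).trans (by gcongr; exact hCG' i))
    (hCP.mono fun s h M hM => (h M hM).trans (by gcongr))] with ξ h W hW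
  have h1 := h W hW
  rw [hz, sub_zero, Real.mul_rpow (by positivity) (norm_nonneg _)] at h1
  refine h1.trans_eq ?_
  ring

end Stack

/-! ### The losses of the minimax problem. -/

section Minimax

variable {n m N : ℕ} {Q : Problem n m N}

theorem Problem.SmoothStronglyConvexConcave.conj_lossX (h : Q.SmoothStronglyConvexConcave)
    (y : EuclideanSpace ℝ (Fin m)) (i : Fin N) : ∃ c K : ℝ, 0 < c ∧ 0 < K ∧
      conjDomInt (Q.lossX y i) = univ ∧
      SubgradientMap (conjReal (Q.lossX y i)) (gradConj (Q.lossX y i)) c K := by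
  obtain ⟨μ, hμ, hstrong⟩ := h.strongConvex i
  obtain ⟨Lg, hLg, hg⟩ := h.g_lip i
  obtain ⟨Lf, hLf, hf⟩ := h.f_lip i
  have hdg : Differentiable ℝ (Q.g i) := (h.g_smooth i).differentiable one_ne_zero
  have hdf : Differentiable ℝ fun x => Q.f i x y :=
    ((h.f_smooth i).differentiable one_ne_zero).comp
      (differentiable_id.prodMk (differentiable_const y))
  have hgrad : ∀ x, HasGradientAt (Q.lossX y i)
      (gradient (Q.g i) x + gradient (fun x => Q.f i x y) x) x := fun x => by
    rw [hasGradientAt_iff_hasFDerivAt, map_add]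
    exact (hdg x).hasGradientAt.hasFDerivAt.add (hdf x).hasGradientAt.hasFDerivAt
  refine ⟨μ / (Lg + Lf) ^ 2, 1 / μ, by positivity, by positivity,
    conj_of_stronglyConvex hμ (by positivity) (hstrong y) hgrad fun x x' => ?_⟩
  have h1 := hg x' x
  -- With equal second arguments, the joint Lipschitz bound becomes one for the partial gradient.
  have h2 := (le_max_left _ _).trans (hf x' x y y)
  rw [sub_self, norm_zero, zero_pow two_ne_zero, add_zero, Real.sqrt_sq (norm_nonneg _)] at h2
  rw [add_sub_add_comm, add_mul]
  exact (norm_add_le _ _).trans (add_le_add h1 h2)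

theorem Problem.SmoothStronglyConvexConcave.conj_lossY (h : Q.SmoothStronglyConvexConcave)
    (x : EuclideanSpace ℝ (Fin n)) (i : Fin N) : ∃ c K : ℝ, 0 < c ∧ 0 < K ∧
      conjDomInt (Q.lossY x i) = univ ∧
      SubgradientMap (conjReal (Q.lossY x i)) (gradConj (Q.lossY x i)) c K := by
  obtain ⟨μ, hμ, hstrong⟩ := h.strongConcave i
  obtain ⟨Lh, hLh, hh⟩ := h.h_lip i
  obtain ⟨Lf, hLf, hf⟩ := h.f_lip i
  have hdh : Differentiable ℝ (Q.h i) := (h.h_smooth i).differentiable one_ne_zero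
  have hdf : Differentiable ℝ fun y => Q.f i x y :=
    ((h.f_smooth i).differentiable one_ne_zero).comp
      ((differentiable_const x).prodMk differentiable_id)
  have hgrad : ∀ y, HasGradientAt (Q.lossY x i)
      (gradient (Q.h i) y - gradient (fun y => Q.f i x y) y) y := fun y => by
    rw [hasGradientAt_iff_hasFDerivAt, map_sub]
    exact (hdh y).hasGradientAt.hasFDerivAt.sub (hdf y).hasGradientAt.hasFDerivAt
  have hconv : StrongConvexOn univ μ (Q.lossY x i) := by
    have := (hstrong x).neg
    have e : -(fun y => -Q.h i y + Q.f i x y) = Q.lossY x i := by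
      ext y; simp only [Pi.neg_apply, Problem.lossY]; ring
    rwa [e] at this
  refine ⟨μ / (Lh + Lf) ^ 2, 1 / μ, by positivity, by positivity,
    conj_of_stronglyConvex hμ (by positivity) hconv hgrad fun y y' => ?_⟩
  have h1 := hh y' y
  have h2 := (le_max_right _ _).trans (hf x x y' y)
  rw [sub_self, norm_zero, zero_pow two_ne_zero, zero_add, Real.sqrt_sq (norm_nonneg _)] at h2
  rw [sub_sub_sub_comm, add_mul]
  exact (norm_sub_le _ _).trans (add_le_add h1 h2)

end Minimax

end SSN

theorem theorem3p1 {n m N b : ℕ} (hb : 0 < b) (Q : SSN.Problem n m N)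
    (hsmooth : Q.SmoothStronglyConvexConcave) (hreg : Q.ClosedConvexRegularizers)
    (hprox : Q.SemismoothProx)
    (hconj : Q.RegularConjugates) (hsemi : Q.SemismoothConjugates)
    (κ : Fin b → Fin N) (α : ℝ) (hα : 0 < α) (P : SSN.Params)
    (x xFix vx : EuclideanSpace ℝ (Fin n)) (y yFix vy : EuclideanSpace ℝ (Fin m)) :
    (∃ ξs ∈ (Q.subX κ α yFix x vx).domain,
      (Q.subX κ α yFix x vx).F ξs = 0 ∧
      (∀ ζ ∈ (Q.subX κ α yFix x vx).domain, (Q.subX κ α yFix x vx).F ζ = 0 → ζ = ξs) ∧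
      ∀ ξ W d ℓ, SSN.IsRun (Q.subX κ α yFix x vx) P 0 ξ W d ℓ →
        SSN.ConvergesSuperlinearly ξ ξs ∧
        (∀ᶠ j in atTop, (Q.subX κ α yFix x vx).F (ξ j) ≠ 0 → ℓ j = 0) ∧
        ∀ ν : ℝ, ν ∈ Ioc (0 : ℝ) 1 → Q.OrderSemismoothProx ν → Q.OrderSemismoothConjugates ν →
          SSN.ConvergesWithOrder (1 + min P.τ ν) ξ ξs) ∧
    (∃ ξs ∈ (Q.subY κ α xFix y vy).domain,
      (Q.subY κ α xFix y vy).F ξs = 0 ∧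
      (∀ ζ ∈ (Q.subY κ α xFix y vy).domain, (Q.subY κ α xFix y vy).F ζ = 0 → ζ = ξs) ∧
      ∀ ξ W d ℓ, SSN.IsRun (Q.subY κ α xFix y vy) P 0 ξ W d ℓ →
        SSN.ConvergesSuperlinearly ξ ξs ∧
        (∀ᶠ j in atTop, (Q.subY κ α xFix y vy).F (ξ j) ≠ 0 → ℓ j = 0) ∧
        ∀ ν : ℝ, ν ∈ Ioc (0 : ℝ) 1 → Q.OrderSemismoothProx ν → Q.OrderSemismoothConjugates ν →
          SSN.ConvergesWithOrder (1 + min P.τ ν) ξ ξs) := by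
  constructor
  · obtain ⟨ξs, h1, h2, h3, h4⟩ := (Q.subX κ α yFix x vx).newton_convergence hb hα hreg.φ_convex
      (fun i => hsmooth.conj_lossX yFix (κ i)) (hprox.φ_prox α hα)
      (fun i => hsemi.semiX yFix (κ i)) P
    refine ⟨ξs, h1, h2, h3, fun ξ W d ℓ hrun => ?_⟩
    obtain ⟨h5, h6, h7⟩ := h4 ξ W d ℓ hrun
    exact ⟨h5, h6, fun ν hν hP hG =>
      h7 ν hν.1 (hP.φ_prox α hα) fun i => hG.semiX yFix (κ i)⟩
  · obtain ⟨ξs, h1, h2, h3, h4⟩ := (Q.subY κ α xFix y vy).newton_convergence hb hα hreg.ψ_convex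
      (fun i => hsmooth.conj_lossY xFix (κ i)) (hprox.ψ_prox α hα)
      (fun i => hsemi.semiY xFix (κ i)) P
    refine ⟨ξs, h1, h2, h3, fun ξ W d ℓ hrun => ?_⟩
    obtain ⟨h5, h6, h7⟩ := h4 ξ W d ℓ hrun
    exact ⟨h5, h6, fun ν hν hP hG =>
      h7 ν hν.1 (hP.ψ_prox α hα) fun i => hG.semiY xFix (κ i)⟩
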